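/- **Setting.** Let $G$ be an abelian group with identity $e$, and let $p$ be a finitely supported probability on $G$ whose support $S$ generates $G$ as a semigroup. Assume that $p$ is aperiodic, i.e. $\gcd\{n\ge 1: p^{\ast n}(e)>0\}=1$. For letters $A,a\in S$, a function $c:\mathbb N\to(0,\infty)$, $t>0$ and $N\in\mathbb N$, put $$\phi_{c;\le N}[t](g)=\sum_{n=1}^N t^{-n}c_n\sum_{\substack{w=w_1\cdots w_n\in S^n,\ w_1=A,\ w_n=a\\ w_1w_2\cdots w_n=g}}p(w_1)\cdots p(w_n)\qquad(g\in G).$$ Write $\phi_{\le N}[t]$ when $c\equiv 1$, and $\phi^*(g)=\phi(g^{-1})$. Let $\rho$ be the left regular representation on $\ell^2(G)$, $[\rho(g)f](x)=f(g^{-1}x)$, and put $\phi\ast_\rho f=\sum_h\phi(h)\rho(h)f$. Let $$\gamma(\delta_e)=\inf\Big\{t>0:\ \sup_N\sum_h\langle\rho(h)\delta_e,\delta_e\rangle\,\phi_{\le N}[t](h)<\infty\Big\}.$$ Call $c$ slowly increasing if it is positive, nondecreasing, tends to $\infty$, and $c_{n+1}/c_n\to1$. Consider slowly increasing $c$ such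 that the limits $$E(t)=\lim_N\langle\phi_{c;\le N}[t]\ast_\rho\delta_e,\delta_e\rangle,\qquad F(t)=\lim_N\langle\phi_{c;\le N}[t]\ast_\rho\delta_e,\phi^*_{c;\le N}[t]\ast_\rho\delta_e\rangle$$ exist for all $t>\gamma(\delta_e)$, and $F(t)\to\infty$, $E(t)/F(t)\to0$ as $t\downarrow\gamma(\delta_e)$. For such a $c$ and a sequence $t_k\to\gamma(\delta_e)$ with $t_k>\gamma(\delta_e)$, let $$\Upsilon_{c,*}(g)=\limsup_{k\to\infty}\lim_{N\to\infty}\frac{\langle\rho(g)(\phi_{c;\le N}[t_k]\ast_\rho\delta_e),\ \phi^*_{c;\le N}[t_k]\ast_\rho\delta_e\rangle}{\langle\phi_{c;\le N}[t_k]\ast_\rho\delta_e,\ \phi^*_{c;\le N}[t_k]\ast_\rho\delta_e\rangle}.$$ **Statement.** The limit $\gamma=\lim_n p^{\ast n}(e)^{1/n}$ exists, and there is a unique positive $\gamma$-harmonic function $\Psi:G\to\mathbb R$, $\sum_{s\in S}p(s)\Psi(xs)=\gamma\Psi(x)$, such that $$\lim_{n\to\infty}\frac{p^{\ast n}(x)}{p^{\ast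 n}(e)}=\frac1{\Psi(x)}\qquad\text{for all }x\in G.$$ For all $A,a\in S$ one has $\gamma(\delta_e)=\gamma$, functions $c$ as above exist, and for every such $c$ and every such sequence $(t_k)$ the function $\Upsilon_{c,*}$ is well defined (the limits in $N$ exist and are bounded in $k$) and satisfies $$\Upsilon_{c,*}(g)=\frac1{\Psi(g^{-1})}\qquad\text{for all }g\in G.$$ -/

import Mathlib

open Filter Topology

noncomputable section

namespace RandomWalkDensity

/-! A finitely supported function on a group `G` is an element of `MonoidAlgebra ℝ G`, whose product
is convolution: `(p ^ n).coeff x` is the `n`-fold convolution power `p^{*n}(x)`. -/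

/-- `p` is a finitely supported probability on `G`. -/
structure IsProbability {G : Type*} [Group G] (p : MonoidAlgebra ℝ G) : Prop where
  nonneg : ∀ x, 0 ≤ p.coeff x
  sum_eq_one : ∑ x ∈ p.coeff.support, p.coeff x = 1

/-- The support of `p` generates `G` as a semigroup. -/
def GeneratesAsSemigroup {G : Type*} [Group G] (p : MonoidAlgebra ℝ G) : Prop :=
  Subsemigroup.closure (p.coeff.support : Set G) = ⊤

/-- The greatest common divisor of `{n ≥ 1 : p^{*n}(e) > 0}` is `1`. -/
def IsAperiodic {G : Type*} [Group G] (p : MonoidAlgebra ℝ G) : Prop :=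
  ∀ d : ℕ, (∀ n : ℕ, 0 < n → 0 < (p ^ n).coeff 1 → d ∣ n) → d = 1

/-- `Ψ` is a positive `γ`-harmonic function, `∑ₛ p(s) Ψ(x s) = γ Ψ(x)`, for which
`p^{*n}(x) / p^{*n}(e) → 1 / Ψ(x)` for every `x`. -/
structure IsRatioLimitFunction {G : Type*} [Group G] (p : MonoidAlgebra ℝ G) (γ : ℝ)
    (Ψ : G → ℝ) : Prop where
  pos : ∀ x, 0 < Ψ x
  harmonic : ∀ x, ∑ s ∈ p.coeff.support, p.coeff s * Ψ (x * s) = γ * Ψ x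
  ratio_limit : ∀ x,
    Tendsto (fun n : ℕ => (p ^ n).coeff x / (p ^ n).coeff 1) atTop (𝓝 (1 / Ψ x))

/-! ### The left regular representation in `ℓ²(G)` -/

/-- The real Hilbert space `ℓ²(G)`. -/
abbrev ell2 (G : Type*) := lp (fun _ : G => ℝ) 2

theorem memlp_translate {G : Type*} [Group G] (g : G) (f : ell2 G) :
    Memℓp (fun x : G => f (g⁻¹ * x)) 2 := by
  have hpos : 0 < (2 : ENNReal).toReal := by norm_num
  rw [memℓp_gen_iff hpos]
  exact ((memℓp_gen_iff hpos).1 (lp.memℓp f)).comp_injective (mul_right_injective g⁻¹)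

/-- The left regular representation, `(ρ(g) f)(x) = f(g⁻¹ x)`. -/
def leftRegular (G : Type*) [Group G] : Representation ℝ G (ell2 G) where
  toFun g :=
    { toFun := fun f => ⟨fun x => f (g⁻¹ * x), memlp_translate g f⟩
      map_add' := fun _ _ => rfl
      map_smul' := fun _ _ => rfl }
  map_one' := by
    ext f x
    change f ((1 : G)⁻¹ * x) = f x
    simp
  map_mul' g h := by
    ext f x
    change f ((g * h)⁻¹ * x) = f (h⁻¹ * (g⁻¹ * x))
    simp [mul_assoc]

open Classical in
/-- The indicator function of the identity, as a vector of `ℓ²(G)`. -/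
def deltaOne (G : Type*) [Group G] : ell2 G := lp.single 2 (1 : G) (1 : ℝ)

/-- `φ ∗_ρ f = ∑ₕ φ(h) ρ(h) f` for the left regular representation `ρ`
(used only for finitely supported `φ`). -/
def convVec {G : Type*} [Group G] (φ : G → ℝ) (f : ell2 G) : ell2 G :=
  ∑' h : G, φ h • leftRegular G h f

/-- `φ^*(g) = φ(g⁻¹)`. -/
def adj {G : Type*} [Group G] (φ : G → ℝ) : G → ℝ := fun g => φ g⁻¹

/-! ### The thermodynamic density of the random walk

The group extension of the random walk: the shift is the full shift on the alphabet
`S = supp p`, the letter `s` is sent to the group element `s`, and the potential `R = p` depends on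
the first letter only, so that `R_n(w x) = p(w_1) ⋯ p(w_n)` for every word `w` of length `n` and
every `x`. -/

/-- The alphabet: the support of `p`. -/
abbrev Letter {G : Type*} [Group G] (p : MonoidAlgebra ℝ G) := {s : G // s ∈ p.coeff.support}

/-- The words of length `n` with first letter `A` and last letter `a`. -/
def words {G : Type*} [Group G] (p : MonoidAlgebra ℝ G) (A a : Letter p) (n : ℕ) :
    Set (Fin n → Letter p) :=
  {w | ∃ h : 0 < n, w ⟨0, h⟩ = A ∧ w ⟨n - 1, Nat.sub_lt h Nat.one_pos⟩ = a}

/-- The group element `w_1 w_2 ⋯ w_n`. -/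
def wordProd {G : Type*} [Group G] {p : MonoidAlgebra ℝ G} {n : ℕ} (w : Fin n → Letter p) : G :=
  (List.ofFn fun i => (w i : G)).prod

open Classical in
/-- The partial sums
`φ_{c;≤N}[t](g) = ∑_{n=1}^N t^{-n} c_n ∑_{w ∈ W_n^{A,a}, w_1⋯w_n = g} p(w_1)⋯p(w_n)`. -/
def density {G : Type*} [Group G] (p : MonoidAlgebra ℝ G) (A a : Letter p) (c : ℕ → ℝ) (N : ℕ)
    (t : ℝ) (g : G) : ℝ :=
  ∑ n ∈ Finset.Icc 1 N, (t ^ n)⁻¹ * c n *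
    ∑ w : Fin n → Letter p with w ∈ words p A a n ∧ wordProd w = g, ∏ i, p.coeff (w i : G)

/-- The convergence parameter `γ(δ_e)`: the infimum of the `t > 0` for which
`∑ₕ ⟨ρ(h) δ_e, δ_e⟩ φ_{≤N}[t](h)` is bounded in `N` (with weight `c = 1`). -/
def convParam {G : Type*} [Group G] (p : MonoidAlgebra ℝ G) (A a : Letter p) : ℝ :=
  sInf {t : ℝ | 0 < t ∧ BddAbove (Set.range fun N : ℕ =>
    ∑' h : G, inner ℝ (leftRegular G h (deltaOne G)) (deltaOne G) *
      density p A a (fun _ => 1) N t h)}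

/-- `⟨ρ(g) (φ_{c;≤N}[t] ∗_ρ δ_e), φ^*_{c;≤N}[t] ∗_ρ δ_e⟩`. -/
def coeffStar {G : Type*} [Group G] (p : MonoidAlgebra ℝ G) (A a : Letter p) (c : ℕ → ℝ) (N : ℕ)
    (t : ℝ) (g : G) : ℝ :=
  inner ℝ (leftRegular G g (convVec (density p A a c N t) (deltaOne G)))
    (convVec (adj (density p A a c N t)) (deltaOne G))

/-- `c` is slowly increasing: positive, nondecreasing, unbounded, with `c_{n+1} / c_n → 1`. -/
structure SlowlyIncreasing (c : ℕ → ℝ) : Prop where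
  pos : ∀ n, 0 < c n
  mono : Monotone c
  tendsto_atTop : Tendsto c atTop atTop
  ratio : Tendsto (fun n => c (n + 1) / c n) atTop (𝓝 1)

/-- The slowly increasing functions `c` used to define `Υ_{c,*}`. Write
`E(t) = lim_N ⟨φ_{c;≤N}[t] ∗ δ_e, δ_e⟩` and
`F(t) = lim_N ⟨φ_{c;≤N}[t] ∗ δ_e, φ^*_{c;≤N}[t] ∗ δ_e⟩` for `t > γ(δ_e)`; it is required that
`F(t) → ∞` and `E(t) / F(t) → 0` as `t` decreases to `γ(δ_e)`. -/
structure IsDivergenceWeight {G : Type*} [Group G] (p : MonoidAlgebra ℝ G) (A a : Letter p)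
    (c : ℕ → ℝ) : Prop where
  slow : SlowlyIncreasing c
  divergence : ∃ E F : ℝ → ℝ,
    (∀ t, convParam p A a < t → Tendsto (fun N : ℕ =>
      inner ℝ (convVec (density p A a c N t) (deltaOne G)) (deltaOne G)) atTop (𝓝 (E t))) ∧
    (∀ t, convParam p A a < t → Tendsto (fun N : ℕ =>
      coeffStar p A a c N t 1) atTop (𝓝 (F t))) ∧
    Tendsto F (𝓝[>] (convParam p A a)) atTop ∧
    Tendsto (fun t => E t / F t) (𝓝[>] (convParam p A a)) (𝓝 0)

/-- The quotient whose iterated limit is `Υ_{c,*}(g)`. -/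
def quotStar {G : Type*} [Group G] (p : MonoidAlgebra ℝ G) (A a : Letter p) (c : ℕ → ℝ) (N : ℕ)
    (t : ℝ) (g : G) : ℝ :=
  coeffStar p A a c N t g / coeffStar p A a c N t 1

/-- The inner limit `lim_N` of the quotients (meaningful when it exists). -/
def innerLimit {G : Type*} [Group G] (p : MonoidAlgebra ℝ G) (A a : Letter p) (c : ℕ → ℝ)
    (t : ℝ) (g : G) : ℝ :=
  limUnder atTop fun N : ℕ => quotStar p A a c N t g

/-- `Υ_{c,*}(g) = limsup_k lim_N` of the quotients at `t = t_k` (meaningful when the inner limits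
exist and are bounded in `k`). -/
def upsilonStar {G : Type*} [Group G] (p : MonoidAlgebra ℝ G) (A a : Letter p) (c : ℕ → ℝ)
    (t : ℕ → ℝ) (g : G) : ℝ :=
  limsup (fun k : ℕ => innerLimit p A a c (t k) g) atTop

end RandomWalkDensity

end

open Filter Topology

noncomputable section

namespace RandomWalkDensity

/-! ### Concentration for superadditive arrays -/

/-! Since `G` is abelian, the weight of a word and its product depend only on how often each letter
occurs. Fix a letter `s`. The binomial theorem splits `p^{*n}(x)` according to the number `j` of
occurrences of `s`, and the mean of `j / (n+1)` over words of length `n + 1` with product `x` is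
`p(s) p^{*n}(x s⁻¹) / p^{*(n+1)}(x)`. So a ratio limit follows once this mean frequency converges.

Convergence comes from concentration. For `x = e` the weights are binomial coefficients times a
supermultiplicative array. Multiplying two arrangements of equal length `n` whose frequencies differ
by `d` gains a factor `exp(n d² / 4)`, up to a polynomial factor (`weight_mul_exp_le`). If both
weights are near the maximal growth `γ^n`, the product would exceed `γ^{2n}` unless `d` is small.
Hence near-maximal frequencies cluster at one point `α` (`exists_frequency`). A general `x` is
reduced to `e` by a fixed closing word, so the mean frequency tends to the same `α` for every `x`
(`tendsto_mean_frequency`, `exists_removal_limit`).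

Limits for letters multiply to limits for words (`exists_hasRemovalLimit`). They are positive
because words can be completed to cycles. Cycles of consecutive lengths give `p^{*(n+1)}(e) /
p^{*n}(e) → γ`, and then `h(x) = lim p^{*n}(x) / p^{*n}(e)` exists and is multiplicative, because
removal limits do not depend on `x` (`exists_isRatioLimit`). The required function is `Ψ = 1 / h`.

For `Υ`, the inner product against the adjoint is the coefficient at `g⁻¹` of the convolution square
of the density (`coeffStar_eq`). Fixing the end letters only translates and rescales a power of `p`,
so all but finitely many terms at `g⁻¹` are nearly `h(g⁻¹)` times those at `e`. The exceptional
terms are bounded uniformly in `t` and vanish against `F(t) → ∞` (`upsilonStar_spec`). A weight `c`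
is built from the running maximum of `γ^n / p^{*n}(e)` (`exists_isDivergenceWeight`). -/

theorem choose_le_two_pow_mul_exp (a b : ℕ) :
    ((a + b).choose a : ℝ) ≤ 2 ^ (a + b) * Real.exp (-((a : ℝ) - b) ^ 2 / (2 * (a + b))) := by
  rcases Nat.eq_zero_or_pos (a + b) with h0 | h0
  · obtain ⟨rfl, rfl⟩ : a = 0 ∧ b = 0 := by omega
    simp
  have hN : (0 : ℝ) < (a : ℝ) + b := by exact_mod_cast h0
  -- Chernoff bound: the binomial coefficient is read off from one term of `(e^l + e^{-l})^(a+b)`,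
  -- which is at most `2^(a+b) exp((a+b) l² / 2)`. This `l` minimises the resulting estimate.
  set l : ℝ := ((a : ℝ) - b) / (a + b) with hl
  have h1 : ((a + b).choose a : ℝ) * (Real.exp l ^ a * Real.exp (-l) ^ b)
      ≤ (Real.exp l + Real.exp (-l)) ^ (a + b) := by
    rw [add_pow]
    have := Finset.single_le_sum (s := Finset.range (a + b + 1))
      (f := fun m => Real.exp l ^ m * Real.exp (-l) ^ (a + b - m) * ((a + b).choose m : ℝ))
      (fun i _ => by positivity) (Finset.mem_range.2 (by omega : a < a + b + 1))
    simp only [Nat.add_sub_cancel_left] at this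
    linarith
  have h2 : (Real.exp l + Real.exp (-l)) ^ (a + b)
      ≤ 2 ^ (a + b) * Real.exp (l ^ 2 / 2) ^ (a + b) := by
    rw [← mul_pow]
    refine pow_le_pow_left₀ (by positivity) ?_ _
    have := Real.cosh_le_exp_half_sq l
    rw [Real.cosh_eq] at this
    linarith
  have h3 : Real.exp l ^ a * Real.exp (-l) ^ b = Real.exp (l * (a - b)) := by
    rw [← Real.exp_nat_mul, ← Real.exp_nat_mul, ← Real.exp_add]
    ring_nf
  have h4 : Real.exp (l ^ 2 / 2) ^ (a + b)
      = Real.exp (-((a : ℝ) - b) ^ 2 / (2 * (a + b))) * Real.exp (l * (a - b)) := by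
    rw [← Real.exp_nat_mul, ← Real.exp_add]
    congr 1
    rw [hl]
    push_cast
    field_simp
    ring
  rw [h3] at h1
  rw [h4, ← mul_assoc] at h2
  exact le_of_mul_le_mul_right (h1.trans h2) (Real.exp_pos _)

/-- One term of Vandermonde's identity. -/
theorem choose_mul_choose_le (j k j' k' : ℕ) :
    (j + k).choose j * (j' + k').choose j' ≤ (j + j' + (k + k')).choose (j + j') := by
  rw [show j + j' + (k + k') = (j + k) + (j' + k') by ring, Nat.add_choose_eq (j + k)]
  exact Finset.single_le_sum (s := Finset.HasAntidiagonal.antidiagonal (j + j'))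
    (f := fun ij : ℕ × ℕ => (j + k).choose ij.1 * (j' + k').choose ij.2)
    (fun _ _ => Nat.zero_le _) (a := (j, j')) (by simp)

/-- The identity `key` trades the two binomials for `choose (2n) (j+j')` times `choose (j+j') j *
choose (k+k') k / choose (2n) n`. The central binomial is at least `4^n / (2n)`, and the off-centre
`choose (j+j') j` supplies the Gaussian factor. -/
theorem choose_mul_choose_mul_exp_le {n j k j' k' : ℕ} (hn : 0 < n) (h : j + k = n)
    (h' : j' + k' = n) :
    ((j + k).choose j : ℝ) * (j' + k').choose j' * Real.exp (((j : ℝ) - j') ^ 2 / (4 * n))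
      ≤ 2 * n * (j + j' + (k + k')).choose (j + j') := by
  have key : (2 * n).choose n * ((j + k).choose j * (j' + k').choose j')
      = (j + j' + (k + k')).choose (j + j') * ((j + j').choose j * (k + k').choose k) := by
    have e1 := Nat.choose_symm_add (a := j) (b := k) ▸
      Nat.add_choose_mul_factorial_mul_factorial j k
    have e2 := Nat.choose_symm_add (a := j') (b := k') ▸
      Nat.add_choose_mul_factorial_mul_factorial j' k'
    have e3 := Nat.choose_symm_add (a := j) (b := j') ▸
      Nat.add_choose_mul_factorial_mul_factorial j j'
    have e4 := Nat.choose_symm_add (a := k) (b := k') ▸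
      Nat.add_choose_mul_factorial_mul_factorial k k'
    have e5 := Nat.choose_symm_add (a := j + j') (b := k + k') ▸
      Nat.add_choose_mul_factorial_mul_factorial (j + j') (k + k')
    have e6 := Nat.add_choose_mul_factorial_mul_factorial n n
    rw [show j + j' + (k + k') = 2 * n by omega] at e5 ⊢
    rw [← two_mul] at e6
    rw [h] at e1 ⊢
    rw [h'] at e2 ⊢
    have hp : 0 < j.factorial * k.factorial * (j'.factorial * k'.factorial) := by positivity
    refine Nat.eq_of_mul_eq_mul_right hp ?_
    calc _ = (2 * n).choose n * (n.choose j * j.factorial * k.factorial)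
            * (n.choose j' * j'.factorial * k'.factorial) := by ring
      _ = (2 * n).choose (j + j') * ((j + j').choose j * j.factorial * j'.factorial)
            * ((k + k').choose k * k.factorial * k'.factorial) := by
          rw [e1, e2, e3, e4, e5, e6]
      _ = _ := by ring
  have keyR : ((2 * n).choose n : ℝ) * (((j + k).choose j : ℝ) * (j' + k').choose j')
      = ((j + j' + (k + k')).choose (j + j') : ℝ) * ((j + j').choose j * (k + k').choose k) := by
    exact_mod_cast key
  have hc : (4 : ℝ) ^ n ≤ 2 * n * ((2 * n).choose n : ℝ) := by
    exact_mod_cast Nat.four_pow_le_two_mul_self_mul_centralBinom n hn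
  have h1 : ((j + j').choose j : ℝ)
      ≤ 2 ^ (j + j') * Real.exp (-(((j : ℝ) - j') ^ 2 / (4 * n))) := by
    refine (choose_le_two_pow_mul_exp j j').trans ?_
    gcongr
    rw [neg_div, neg_le_neg_iff]
    rcases Nat.eq_zero_or_pos (j + j') with h0 | h0
    · obtain ⟨rfl, rfl⟩ : j = 0 ∧ j' = 0 := by omega
      simp
    · have : (0 : ℝ) < (j : ℝ) + j' := by exact_mod_cast h0
      have h2 : (j : ℝ) + j' ≤ 2 * n := by exact_mod_cast (by omega : j + j' ≤ 2 * n)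
      exact div_le_div_of_nonneg_left (sq_nonneg _) (by positivity) (by linarith)
  have h2 : ((k + k').choose k : ℝ) ≤ 2 ^ (k + k') := by
    exact_mod_cast Nat.choose_le_two_pow (k + k') k
  have h4 : (2 : ℝ) ^ (j + j') * 2 ^ (k + k') = 4 ^ n := by
    rw [← pow_add, show j + j' + (k + k') = 2 * n by omega, pow_mul]
    norm_num
  set X : ℝ := ((j + k).choose j : ℝ) * (j' + k').choose j'
  set Z : ℝ := ((j + j' + (k + k')).choose (j + j') : ℝ)
  set T := ((j : ℝ) - j') ^ 2 / (4 * n)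
  have h5 : (4 : ℝ) ^ n * X ≤ 4 ^ n * (2 * n * Z * Real.exp (-T)) := by
    calc (4 : ℝ) ^ n * X ≤ 2 * n * ((2 * n).choose n : ℝ) * X := by gcongr
      _ = 2 * n * (Z * ((j + j').choose j * (k + k').choose k)) := by rw [← keyR]; ring
      _ ≤ 2 * n * (Z * (2 ^ (j + j') * Real.exp (-T) * 2 ^ (k + k'))) := by gcongr
      _ = 2 * n * (Z * Real.exp (-T)) * (2 ^ (j + j') * 2 ^ (k + k')) := by ring
      _ = _ := by rw [h4]; ring
  have h6 := le_of_mul_le_mul_left h5 (by positivity)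
  calc X * Real.exp T ≤ 2 * n * Z * Real.exp (-T) * Real.exp T := by gcongr
    _ = 2 * n * Z := by rw [mul_assoc, ← Real.exp_add]; simp

/-- The number of arrangements of `j` letters of one kind and `k` of another, weighted by `R`. -/
def arrangementWeight (R : ℕ → ℕ → ℝ) (j k : ℕ) : ℝ := (j + k).choose j * R j k

/-- An array that is nonnegative and superadditive in the multiplicative sense. -/
structure IsSupermultiplicative (R : ℕ → ℕ → ℝ) : Prop where
  nonneg : ∀ j k, 0 ≤ R j k
  one_le : 1 ≤ R 0 0
  mul_le : ∀ j k j' k', R j k * R j' k' ≤ R (j + j') (k + k')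

namespace IsSupermultiplicative

variable {R : ℕ → ℕ → ℝ}

theorem weight_nonneg (hR : IsSupermultiplicative R) (j k : ℕ) : 0 ≤ arrangementWeight R j k :=
  mul_nonneg (Nat.cast_nonneg _) (hR.nonneg j k)

theorem weight_mul_le (hR : IsSupermultiplicative R) (j k j' k' : ℕ) :
    arrangementWeight R j k * arrangementWeight R j' k'
      ≤ arrangementWeight R (j + j') (k + k') := by
  unfold arrangementWeight
  calc _ = (((j + k).choose j : ℝ) * (j' + k').choose j') * (R j k * R j' k') := by ring
    _ ≤ _ := by
      gcongr
      · exact mul_nonneg (hR.nonneg _ _) (hR.nonneg _ _)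
      · exact_mod_cast choose_mul_choose_le j k j' k'
      · exact hR.mul_le _ _ _ _

theorem weight_pow_le (hR : IsSupermultiplicative R) (j k m : ℕ) :
    arrangementWeight R j k ^ m ≤ arrangementWeight R (m * j) (m * k) := by
  induction m with
  | zero => simpa [arrangementWeight] using hR.one_le
  | succ m ih =>
    rw [pow_succ, add_mul, add_mul, one_mul, one_mul]
    exact (mul_le_mul_of_nonneg_right ih (hR.weight_nonneg j k)).trans
      (hR.weight_mul_le _ _ _ _)

theorem weight_mul_exp_le (hR : IsSupermultiplicative R) {n j k j' k' : ℕ} (hn : 0 < n)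
    (h : j + k = n) (h' : j' + k' = n) :
    arrangementWeight R j k * arrangementWeight R j' k' * Real.exp (((j : ℝ) - j') ^ 2 / (4 * n))
      ≤ 2 * n * arrangementWeight R (j + j') (k + k') := by
  unfold arrangementWeight
  calc _ = (((j + k).choose j : ℝ) * (j' + k').choose j' *
          Real.exp (((j : ℝ) - j') ^ 2 / (4 * n))) * (R j k * R j' k') := by ring
    _ ≤ (2 * n * (j + j' + (k + k')).choose (j + j')) * R (j + j') (k + k') :=
      mul_le_mul (choose_mul_choose_mul_exp_le hn h h') (hR.mul_le _ _ _ _)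
        (mul_nonneg (hR.nonneg _ _) (hR.nonneg _ _)) (by positivity)
    _ = _ := by ring

/-- Powers of the two arrangements are brought to a common length `L`. If the frequencies were too
far apart, the Gaussian gain would beat the loss `exp(-2δL)` and the product would exceed the bound
`γ^(2L)`, up to the factor `2L`. -/
theorem sq_frequency_sub_le (hR : IsSupermultiplicative R) {γ δ : ℝ} (hγ : 0 < γ)
    (hle : ∀ j k, arrangementWeight R j k ≤ γ ^ (j + k)) {j k j' k' : ℕ} (hn : 0 < j + k)
    (hn' : 0 < j' + k')
    (h : (γ * Real.exp (-δ)) ^ (j + k) ≤ arrangementWeight R j k)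
    (h' : (γ * Real.exp (-δ)) ^ (j' + k') ≤ arrangementWeight R j' k') :
    ((j : ℝ) / ↑(j + k) - (j' : ℝ) / ↑(j' + k')) ^ 2 ≤ 8 * δ := by
  set n := j + k with hdn
  set n' := j' + k' with hdn'
  set D := ((j : ℝ) / n - (j' : ℝ) / n') ^ 2 with hD
  by_contra! hlt
  have hnR : (0 : ℝ) < n := by exact_mod_cast hn
  have hnR' : (0 : ℝ) < n' := by exact_mod_cast hn'
  -- The net exponential rate, gain minus loss. It yields `exp(ε L) ≤ 2 L` along the unbounded
  -- lengths `L = m n n'`, which is absurd for `ε > 0`.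
  set ε := D / 4 - 2 * δ with hε
  have hε0 : 0 < ε := by rw [hε]; linarith
  have hb : ∀ m : ℕ, 0 < m → Real.exp (ε * (m * n * n' : ℝ)) ≤ 2 * (m * n * n' : ℝ) := by
    intro m hm
    set L := m * n * n' with hL
    have hL0 : 0 < L := by positivity
    have hLR : (L : ℝ) = m * n * n' := by rw [hL]; push_cast; ring
    rw [← hLR]
    have e1 : m * n' * j + m * n' * k = L := by rw [hL, hdn]; ring
    have e2 : m * n * j' + m * n * k' = L := by rw [hL, hdn']; ring
    have h1 : (γ * Real.exp (-δ)) ^ L ≤ arrangementWeight R (m * n' * j) (m * n' * k) := by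
      rw [hL, show m * n * n' = n * (m * n') by ring, pow_mul]
      exact (pow_le_pow_left₀ (by positivity) h _).trans (hR.weight_pow_le _ _ _)
    have h2 : (γ * Real.exp (-δ)) ^ L ≤ arrangementWeight R (m * n * j') (m * n * k') := by
      rw [hL, show m * n * n' = n' * (m * n) by ring, pow_mul]
      exact (pow_le_pow_left₀ (by positivity) h' _).trans (hR.weight_pow_le _ _ _)
    have h3 := hR.weight_mul_exp_le hL0 e1 e2
    have h4 := hle (m * n' * j + m * n * j') (m * n' * k + m * n * k')
    rw [show m * n' * j + m * n * j' + (m * n' * k + m * n * k') = L + L by omega] at h4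
    have h5 : (((m * n' * j : ℕ) : ℝ) - ((m * n * j' : ℕ) : ℝ)) ^ 2 / (4 * L) = L * (D / 4) := by
      rw [hD, hLR]
      push_cast
      field_simp
    rw [h5] at h3
    have h6 : (γ * Real.exp (-δ)) ^ L * (γ * Real.exp (-δ)) ^ L * Real.exp (L * (D / 4))
        ≤ 2 * L * γ ^ (L + L) := by
      refine le_trans ?_ (h3.trans (mul_le_mul_of_nonneg_left h4 (by positivity)))
      gcongr
      exact hR.weight_nonneg _ _
    have h7 : (γ * Real.exp (-δ)) ^ L * (γ * Real.exp (-δ)) ^ L * Real.exp (L * (D / 4))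
        = Real.exp (ε * L) * γ ^ (L + L) := by
      rw [mul_pow, ← Real.exp_nat_mul, pow_add, hε]
      rw [show (D / 4 - 2 * δ) * (L : ℝ) = L * -δ + L * -δ + L * (D / 4) by ring, Real.exp_add,
        Real.exp_add]
      ring
    rw [h7] at h6
    exact le_of_mul_le_mul_right h6 (by positivity)
  have hb2 : ∀ m : ℕ, 0 < m → ε ^ 2 * (m * n * n' : ℝ) ≤ 4 := by
    intro m hm
    have h1 := hb m hm
    have hm' : (0 : ℝ) < m * n * n' := by positivity
    set x : ℝ := (m * n * n' : ℝ)
    have h2 := Real.quadratic_le_exp_of_nonneg (x := ε * x) (by positivity)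
    have : (ε ^ 2 * x) * x ≤ 4 * x := by nlinarith [mul_pos hε0 hm']
    exact le_of_mul_le_mul_right this hm'
  obtain ⟨m, hm⟩ := exists_nat_gt (4 / (ε ^ 2 * (n * n')))
  have hm0 : 0 < m := by
    rcases Nat.eq_zero_or_pos m with rfl | h0
    · exact absurd hm (not_lt.2 (by simp; positivity))
    · exact h0
  rw [div_lt_iff₀ (by positivity)] at hm
  nlinarith [hb2 m hm0]

/-- The frequencies of near-maximal arrangements accumulate at a single point. -/
theorem exists_frequency (hR : IsSupermultiplicative R) {γ : ℝ} (hγ : 0 < γ)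
    (hle : ∀ j k, arrangementWeight R j k ≤ γ ^ (j + k))
    (hne : ∀ δ > 0, ∃ j k, 0 < j + k ∧ (γ * Real.exp (-δ)) ^ (j + k) ≤ arrangementWeight R j k) :
    ∃ α : ℝ, ∀ δ > 0, ∀ j k : ℕ, 0 < j + k →
      (γ * Real.exp (-δ)) ^ (j + k) ≤ arrangementWeight R j k →
      ((j : ℝ) / ↑(j + k) - α) ^ 2 ≤ 8 * δ := by
  have hmono : ∀ {δ δ' : ℝ} (_ : δ' ≤ δ) (n : ℕ),
      (γ * Real.exp (-δ)) ^ n ≤ (γ * Real.exp (-δ')) ^ n := by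
    intro δ δ' hd n
    gcongr
  -- The frequencies of arrangements with defect `1 / (m+1)` form a Cauchy sequence, and `α` is its
  -- limit.
  choose! J K hpos hJK using fun m : ℕ => hne (1 / ((m : ℝ) + 1)) (by positivity)
  set f : ℕ → ℝ := fun m => (J m : ℝ) / ↑(J m + K m) with hf
  have hclose : ∀ N m : ℕ, N ≤ m → ∀ δ : ℝ, 1 / ((N : ℝ) + 1) ≤ δ → ∀ j k : ℕ, 0 < j + k →
      (γ * Real.exp (-δ)) ^ (j + k) ≤ arrangementWeight R j k →
      ((j : ℝ) / ↑(j + k) - f m) ^ 2 ≤ 8 * δ := by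
    intro N m hm δ hδ j k h0 h1
    refine hR.sq_frequency_sub_le hγ hle h0 (hpos m) h1 ((hmono ?_ _).trans (hJK m))
    refine le_trans ?_ hδ
    gcongr
  have hlim0 : Tendsto (fun N : ℕ => √(8 * (1 / ((N : ℝ) + 1)))) atTop (𝓝 0) := by
    have := (Real.continuous_sqrt.tendsto _).comp
      ((tendsto_one_div_add_atTop_nhds_zero_nat (𝕜 := ℝ)).const_mul 8)
    simpa only [Function.comp_def, mul_zero, Real.sqrt_zero] using this
  have hcau : CauchySeq f := by
    refine cauchySeq_of_le_tendsto_0' _ (fun N m hm => ?_) hlim0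
    rw [Real.dist_eq, ← Real.sqrt_sq_eq_abs]
    exact Real.sqrt_le_sqrt (hclose N m hm _ le_rfl _ _ (hpos N) (hJK N))
  obtain ⟨α, hα⟩ := cauchySeq_tendsto_of_complete hcau
  refine ⟨α, fun δ hδ j k h0 h1 => ?_⟩
  obtain ⟨N, hN⟩ := exists_nat_one_div_lt hδ
  refine le_of_tendsto ((tendsto_const_nhds.sub hα).pow 2) ?_
  filter_upwards [eventually_ge_atTop N] with m hm
  exact hclose N m hm δ hN.le j k h0 h1

end IsSupermultiplicative

/-- In the application `B n j` is the weight of words with product `x`, and `(j₀, k₀)` are the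
letter counts of a closing word of weight `c`. The closing word moves frequencies by `O(1/n)`. Terms
with frequency far from `α` are then exponentially smaller than the total, and there are at most `n
+ 1` of them. -/
theorem tendsto_mean_frequency {R : ℕ → ℕ → ℝ} {γ α : ℝ} (hγ : 0 < γ)
    (hα : ∀ δ > 0, ∀ j k : ℕ, 0 < j + k →
      (γ * Real.exp (-δ)) ^ (j + k) ≤ arrangementWeight R j k →
      ((j : ℝ) / ↑(j + k) - α) ^ 2 ≤ 8 * δ)
    {B : ℕ → ℕ → ℝ} (hB : ∀ n j, 0 ≤ B n j) {c : ℝ} (hc : 0 < c) {j₀ k₀ : ℕ}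
    (hBR : ∀ n j, j ≤ n → c * B n j ≤ arrangementWeight R (j + j₀) (n - j + k₀))
    (hV : ∀ δ > 0, ∀ᶠ n : ℕ in atTop,
      (γ * Real.exp (-δ)) ^ n ≤ ∑ j ∈ Finset.range (n + 1), B n j) :
    Tendsto (fun n : ℕ => (∑ j ∈ Finset.range (n + 1), (j : ℝ) / n * B n j) /
      ∑ j ∈ Finset.range (n + 1), B n j) atTop (𝓝 α) := by
  rw [Metric.tendsto_nhds]
  intro ε' hε'
  obtain ⟨ε, hε, hεε⟩ : ∃ ε : ℝ, 0 < ε ∧ 2 * ε < ε' := ⟨ε' / 3, by linarith, by linarith⟩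
  -- Chosen so that `8 δ ≤ (ε / 2)²`: half of `ε` pays for the concentration and half for the shift
  -- by the closing word.
  set δ := ε ^ 2 / 64 with hδ
  have hδ0 : 0 < δ := by positivity
  set g := γ * Real.exp (-δ) with hg
  have hg0 : 0 < g := by positivity
  set C := (1 + |α|) * (g ^ (j₀ + k₀) / c) with hC
  have hshift : ∀ᶠ n : ℕ in atTop, ((j₀ + k₀ : ℕ) : ℝ) / n < ε / 2 :=
    (tendsto_const_div_atTop_nhds_zero_nat _).eventually_lt_const (by positivity)
  have hsmall : ∀ᶠ n : ℕ in atTop, ((n : ℝ) + 1) * C * Real.exp (-(δ / 2)) ^ n < ε := by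
    have hr : |Real.exp (-(δ / 2))| < 1 := by
      rw [abs_of_pos (Real.exp_pos _), Real.exp_lt_one_iff]
      linarith
    have h1 := (tendsto_pow_const_mul_const_pow_of_abs_lt_one 1 hr).const_mul C
    have h2 := (tendsto_pow_const_mul_const_pow_of_abs_lt_one 0 hr).const_mul C
    have h3 := h1.add h2
    simp only [mul_zero, add_zero] at h3
    filter_upwards [h3.eventually_lt_const hε] with n hn
    calc _ = _ := by ring
      _ < ε := hn
  filter_upwards [hshift, hsmall, hV (δ / 2) (by positivity), eventually_gt_atTop 0]
    with n h1 h2 h3 hn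
  set V := ∑ j ∈ Finset.range (n + 1), B n j with hVdef
  have hn' : (0 : ℝ) < n := by exact_mod_cast hn
  have hV0 : 0 < V := lt_of_lt_of_le (by positivity) h3
  have hterm : ∀ j ∈ Finset.range (n + 1),
      |((j : ℝ) / n - α) * B n j| ≤ ε * B n j + C * g ^ n := by
    intro j hj
    have hjn : j ≤ n := by simpa [Nat.lt_succ_iff] using hj
    have hjn' : (j : ℝ) ≤ n := by exact_mod_cast hjn
    have hC0 : 0 ≤ C * g ^ n := by positivity
    rw [abs_mul, abs_of_nonneg (hB n j)]
    by_cases hfar : |(j : ℝ) / n - α| ≤ ε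
    · have := mul_le_mul_of_nonneg_right hfar (hB n j)
      linarith
    · push Not at hfar
      have hidx : j + j₀ + (n - j + k₀) = n + (j₀ + k₀) := by omega
      have hw : arrangementWeight R (j + j₀) (n - j + k₀) < g ^ (n + (j₀ + k₀)) := by
        by_contra! hcon
        rw [← hidx] at hcon
        have h4 := hα δ hδ0 _ _ (by omega) hcon
        rw [hidx] at h4
        have h5 : |((j + j₀ : ℕ) : ℝ) / ↑(n + (j₀ + k₀)) - α| ≤ ε / 2 := by
          refine abs_le_of_sq_le_sq (h4.trans ?_) (by positivity)
          rw [hδ]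
          nlinarith [sq_nonneg ε]
        have h6 : |(j : ℝ) / n - ((j + j₀ : ℕ) : ℝ) / ↑(n + (j₀ + k₀))|
            ≤ ((j₀ + k₀ : ℕ) : ℝ) / n := by
          have hl : (0 : ℝ) ≤ (j₀ + k₀ : ℕ) := by positivity
          have e : (j : ℝ) / n - ((j + j₀ : ℕ) : ℝ) / ↑(n + (j₀ + k₀))
              = ((j : ℝ) / n * (j₀ + k₀ : ℕ) - j₀) / ↑(n + (j₀ + k₀)) := by
            push_cast
            field_simp
            ring
          have hq : (j : ℝ) / n ≤ 1 := div_le_one_of_le₀ hjn' hn'.le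
          have hq0 : 0 ≤ (j : ℝ) / n := by positivity
          have hj0 : (j₀ : ℝ) ≤ (j₀ + k₀ : ℕ) := by exact_mod_cast Nat.le_add_right _ _
          rw [e, abs_div, abs_of_pos (by positivity : (0 : ℝ) < ↑(n + (j₀ + k₀)))]
          refine div_le_div₀ hl ?_ hn' (by exact_mod_cast Nat.le_add_right _ _)
          rw [abs_le]
          constructor
          · have := mul_nonneg hq0 hl
            linarith
          · have := mul_le_mul_of_nonneg_right hq hl
            have : (0 : ℝ) ≤ j₀ := Nat.cast_nonneg _
            linarith
        have h7 := abs_sub_le ((j : ℝ) / n) (((j + j₀ : ℕ) : ℝ) / ↑(n + (j₀ + k₀))) α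
        linarith
      have h8 : B n j ≤ g ^ (j₀ + k₀) / c * g ^ n := by
        rw [div_mul_eq_mul_div, le_div_iff₀ hc, mul_comm, ← pow_add, add_comm (j₀ + k₀)]
        exact (hBR n j hjn).trans hw.le
      have h9 : |(j : ℝ) / n - α| ≤ 1 + |α| := by
        refine (abs_sub _ _).trans ?_
        gcongr
        rw [abs_of_nonneg (by positivity)]
        exact div_le_one_of_le₀ hjn' hn'.le
      have h10 : |(j : ℝ) / n - α| * B n j ≤ (1 + |α|) * (g ^ (j₀ + k₀) / c * g ^ n) :=
        mul_le_mul h9 h8 (hB n j) (by positivity)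
      have h11 := mul_nonneg hε.le (hB n j)
      rw [hC]
      linarith
  have hsum : |∑ j ∈ Finset.range (n + 1), ((j : ℝ) / n - α) * B n j| ≤ 2 * ε * V := by
    refine (Finset.abs_sum_le_sum_abs _ _).trans ((Finset.sum_le_sum hterm).trans ?_)
    rw [Finset.sum_add_distrib, ← Finset.mul_sum, Finset.sum_const, Finset.card_range, nsmul_eq_mul]
    have hgn : g ^ n = (γ * Real.exp (-(δ / 2))) ^ n * Real.exp (-(δ / 2)) ^ n := by
      rw [← mul_pow, mul_assoc, ← Real.exp_add, hg]
      ring_nf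
    have : ((n + 1 : ℕ) : ℝ) * (C * g ^ n) ≤ ε * V := by
      calc ((n + 1 : ℕ) : ℝ) * (C * g ^ n)
          = (((n : ℝ) + 1) * C * Real.exp (-(δ / 2)) ^ n) * (γ * Real.exp (-(δ / 2))) ^ n := by
            rw [hgn]; push_cast; ring
        _ ≤ ε * V := mul_le_mul h2.le h3 (by positivity) hε.le
    linarith
  have hdiff : (∑ j ∈ Finset.range (n + 1), (j : ℝ) / n * B n j) / V - α
      = (∑ j ∈ Finset.range (n + 1), ((j : ℝ) / n - α) * B n j) / V := by
    rw [eq_div_iff hV0.ne', sub_mul, div_mul_cancel₀ _ hV0.ne', hVdef, Finset.mul_sum,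
      ← Finset.sum_sub_distrib]
    exact Finset.sum_congr rfl fun j _ => by ring
  rw [Real.dist_eq, hdiff, abs_div, abs_of_pos hV0, div_lt_iff₀ hV0]
  exact hsum.trans_lt (by gcongr)

/-! ### Supermultiplicative sequences -/

/-- Lets a constant factor be absorbed by halving `δ`. -/
theorem eventually_pow_exp_le {γ δ c : ℝ} (hγ : 0 < γ) (hδ : 0 < δ) (hc : 0 < c) :
    ∀ᶠ n : ℕ in atTop, (γ * Real.exp (-δ)) ^ n ≤ c * (γ * Real.exp (-(δ / 2))) ^ n := by
  have h := (tendsto_pow_atTop_nhds_zero_of_lt_one (Real.exp_pos (-(δ / 2))).le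
    (Real.exp_lt_one_iff.2 (by linarith))).eventually_lt_const hc
  filter_upwards [h] with n hn
  have : (γ * Real.exp (-δ)) ^ n
      = Real.exp (-(δ / 2)) ^ n * (γ * Real.exp (-(δ / 2))) ^ n := by
    rw [← mul_pow, mul_left_comm, ← Real.exp_add]
    ring_nf
  rw [this]
  gcongr

/-- Fekete's argument, with `γ` the supremum of `u n ^ (1/n)`. -/
theorem exists_growth_rate {u : ℕ → ℝ} (h0 : ∀ n, 0 ≤ u n) (h1 : ∀ n, u n ≤ 1)
    (hmul : ∀ m n, u m * u n ≤ u (m + n)) (hu0 : u 0 = 1) {K : ℕ} (hpos : ∀ n ≥ K, 0 < u n) :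
    ∃ γ : ℝ, 0 < γ ∧ γ ≤ 1 ∧ (∀ n, u n ≤ γ ^ n) ∧
      ∀ δ > 0, ∀ᶠ n : ℕ in atTop, (γ * Real.exp (-δ)) ^ n ≤ u n := by
  set T : Set ℝ := {y | ∃ n : ℕ, 0 < n ∧ y = u n ^ (1 / (n : ℝ))} with hT
  have hroot : ∀ n : ℕ, 0 < n → (u n ^ (1 / (n : ℝ))) ^ n = u n := by
    intro n hn
    rw [one_div, Real.rpow_inv_natCast_pow (h0 n) hn.ne']
  have hb : BddAbove T := by
    refine ⟨1, ?_⟩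
    rintro _ ⟨n, -, rfl⟩
    exact Real.rpow_le_one (h0 n) (h1 n) (by positivity)
  have hKT : u (K + 1) ^ (1 / ((K + 1 : ℕ) : ℝ)) ∈ T := ⟨K + 1, by omega, rfl⟩
  set γ := sSup T with hγdef
  have hγ : 0 < γ :=
    (Real.rpow_pos_of_pos (hpos (K + 1) (by omega)) _).trans_le (le_csSup hb hKT)
  have hγ1 : γ ≤ 1 := by
    refine csSup_le ⟨_, hKT⟩ ?_
    rintro _ ⟨n, -, rfl⟩
    exact Real.rpow_le_one (h0 n) (h1 n) (by positivity)
  refine ⟨γ, hγ, hγ1, fun n => ?_, fun δ hδ => ?_⟩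
  · rcases Nat.eq_zero_or_pos n with rfl | hn
    · simp [hu0]
    · rw [← hroot n hn]
      exact pow_le_pow_left₀ (Real.rpow_nonneg (h0 n) _) (le_csSup hb ⟨n, hn, rfl⟩) _
  · set h := γ * Real.exp (-(δ / 2)) with hh
    have hh0 : 0 < h := by positivity
    have he : Real.exp (-(δ / 2)) < 1 := Real.exp_lt_one_iff.2 (by linarith)
    have hlt : h < γ := by nlinarith
    obtain ⟨_, ⟨n₀, hn₀, rfl⟩, hy⟩ := exists_lt_of_lt_csSup ⟨_, hKT⟩ hlt
    have hn₀u : h ^ n₀ ≤ u n₀ := by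
      rw [← hroot n₀ hn₀]
      exact pow_le_pow_left₀ hh0.le hy.le _
    -- Remainders are taken in the window `[K, K + n₀)` instead of `[0, n₀)`, since `u` may vanish
    -- below `K`.
    obtain ⟨m, hm, hmin⟩ := Finset.exists_min_image (Finset.Ico K (K + n₀)) u ⟨K, by simp [hn₀]⟩
    have hm0 : 0 < u m := hpos m (Finset.mem_Ico.1 hm).1
    have hpow : ∀ q, h ^ (q * n₀) ≤ u (q * n₀) := by
      intro q
      induction q with
      | zero => simp [hu0]
      | succ q ih =>
        rw [add_mul, one_mul, pow_add]
        exact (mul_le_mul ih hn₀u (by positivity) (h0 _)).trans (hmul _ _)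
    filter_upwards [eventually_ge_atTop K, eventually_pow_exp_le hγ hδ hm0] with n hn hexp
    have hdm : (n - K) / n₀ * n₀ + (K + (n - K) % n₀) = n := by
      have := Nat.div_add_mod' (n - K) n₀
      omega
    have hr : u m ≤ u (K + (n - K) % n₀) :=
      hmin _ (Finset.mem_Ico.2 ⟨by omega, by have := Nat.mod_lt (n - K) hn₀; omega⟩)
    calc (γ * Real.exp (-δ)) ^ n ≤ u m * h ^ n := hexp
      _ ≤ u m * h ^ ((n - K) / n₀ * n₀) := by
        gcongr ?_ * ?_
        exact pow_le_pow_of_le_one hh0.le (hlt.le.trans hγ1) (by omega)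
      _ ≤ u (K + (n - K) % n₀) * u ((n - K) / n₀ * n₀) :=
        mul_le_mul hr (hpow _) (by positivity) (h0 _)
      _ ≤ u n := by
        rw [mul_comm]
        exact (hmul _ _).trans_eq (by rw [hdm])

/-! ### Nonnegative elements of the group algebra -/

section GroupAlgebra

variable {G : Type*}

/-- All coefficients are nonnegative. -/
def IsNonneg (f : MonoidAlgebra ℝ G) : Prop := ∀ x, 0 ≤ f.coeff x

theorem IsNonneg.single {x : G} {r : ℝ} (hr : 0 ≤ r) : IsNonneg (MonoidAlgebra.single x r) := by
  classical
  intro z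
  rw [MonoidAlgebra.coeff_single, Finsupp.single_apply]
  split_ifs <;> simp [hr]

theorem IsNonneg.erase {p : MonoidAlgebra ℝ G} (hp : IsNonneg p) (s : G) :
    IsNonneg (p.erase s) := by
  classical
  intro x
  rw [MonoidAlgebra.coeff_erase, Finsupp.erase_apply]
  split_ifs
  · exact le_rfl
  · exact hp x

variable [CommGroup G]

theorem coeff_mul_eq_sum (f g : MonoidAlgebra ℝ G) (z : G) :
    (f * g).coeff z = ∑ x ∈ f.coeff.support, f.coeff x * g.coeff (x⁻¹ * z) := by
  rw [MonoidAlgebra.coeff_mul_apply_left, Finsupp.sum]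

theorem IsNonneg.mul {f g : MonoidAlgebra ℝ G} (hf : IsNonneg f) (hg : IsNonneg g) :
    IsNonneg (f * g) := fun z => by
  rw [coeff_mul_eq_sum]
  exact Finset.sum_nonneg fun x _ => mul_nonneg (hf x) (hg _)

theorem IsNonneg.pow {f : MonoidAlgebra ℝ G} (hf : IsNonneg f) (n : ℕ) : IsNonneg (f ^ n) := by
  induction n with
  | zero => rw [pow_zero, MonoidAlgebra.one_def]; exact .single zero_le_one
  | succ n ih => rw [pow_succ]; exact ih.mul hf

theorem IsNonneg.coeff_mul_coeff_le {f g : MonoidAlgebra ℝ G} (hf : IsNonneg f) (hg : IsNonneg g)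
    (x y : G) : f.coeff x * g.coeff y ≤ (f * g).coeff (x * y) := by
  rw [coeff_mul_eq_sum]
  by_cases hx : x ∈ f.coeff.support
  · have := Finset.single_le_sum (s := f.coeff.support)
      (f := fun w => f.coeff w * g.coeff (w⁻¹ * (x * y)))
      (fun w _ => mul_nonneg (hf w) (hg _)) hx
    simpa using this
  · rw [Finsupp.notMem_support_iff.1 hx, zero_mul]
    exact Finset.sum_nonneg fun w _ => mul_nonneg (hf w) (hg _)

theorem IsNonneg.pow_coeff_mul_le {f : MonoidAlgebra ℝ G} (hf : IsNonneg f) (m n : ℕ) (x y : G) :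
    (f ^ m).coeff x * (f ^ n).coeff y ≤ (f ^ (m + n)).coeff (x * y) := by
  rw [pow_add]
  exact (hf.pow m).coeff_mul_coeff_le (hf.pow n) x y

theorem IsProbability.isNonneg {p : MonoidAlgebra ℝ G} (hp : IsProbability p) : IsNonneg p :=
  hp.nonneg

theorem IsProbability.pow_coeff_le_one {p : MonoidAlgebra ℝ G} (hp : IsProbability p) (n : ℕ)
    (x : G) : (p ^ n).coeff x ≤ 1 := by
  classical
  induction n generalizing x with
  | zero =>
    rw [pow_zero, MonoidAlgebra.one_def, MonoidAlgebra.coeff_single, Finsupp.single_apply]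
    split_ifs <;> norm_num
  | succ n ih =>
    rw [pow_succ', coeff_mul_eq_sum, ← hp.sum_eq_one]
    exact Finset.sum_le_sum fun y _ => mul_le_of_le_one_right (hp.nonneg y) (ih _)

theorem exists_pow_coeff_pos {p : MonoidAlgebra ℝ G} (hp : IsProbability p)
    (hgen : GeneratesAsSemigroup p) (x : G) : ∃ n, 0 < n ∧ 0 < (p ^ n).coeff x := by
  have hx : x ∈ Subsemigroup.closure (p.coeff.support : Set G) := by rw [hgen]; trivial
  induction hx using Subsemigroup.closure_induction with
  | mem x hx =>
    refine ⟨1, one_pos, ?_⟩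
    rw [pow_one]
    exact (hp.nonneg x).lt_of_ne' (Finsupp.mem_support_iff.1 hx)
  | mul x y _ _ ihx ihy =>
    obtain ⟨m, hm, hmx⟩ := ihx
    obtain ⟨n, hn, hny⟩ := ihy
    exact ⟨m + n, by omega, (mul_pos hmx hny).trans_le (hp.isNonneg.pow_coeff_mul_le m n x y)⟩

/-- Return times are closed under addition, and an additive semigroup of naturals with gcd `1`
contains all large integers. -/
theorem exists_forall_ge_return_pos {p : MonoidAlgebra ℝ G} (hp : IsProbability p)
    (haper : IsAperiodic p) : ∃ K, ∀ n ≥ K, 0 < (p ^ n).coeff 1 := by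
  set s : Set ℕ := {n | 0 < n ∧ 0 < (p ^ n).coeff 1} with hs
  have hgcd : Nat.setGcd s = 1 := haper _ fun n hn hn1 => Nat.setGcd_dvd_of_mem ⟨hn, hn1⟩
  obtain ⟨K, hK⟩ := Nat.exists_mem_closure_of_ge s
  refine ⟨K, fun n hn => ?_⟩
  have hmem := hK n hn (by rw [hgcd]; exact one_dvd n)
  clear hn
  induction hmem using AddSubmonoid.closure_induction with
  | mem n hn => exact hn.2
  | zero => simp
  | add m n _ _ ihm ihn =>
    have := hp.isNonneg.pow_coeff_mul_le m n 1 1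
    rw [one_mul] at this
    exact (mul_pos ihm ihn).trans_le this

/-! ### Removing a letter -/

/-- The contribution to `p^{*n}(x)` of the words which contain the letter `s` exactly `j` times. -/
def letterWeight (p : MonoidAlgebra ℝ G) (s x : G) (n j : ℕ) : ℝ :=
  n.choose j * (p.coeff s ^ j * ((p.erase s) ^ (n - j)).coeff (x * (s ^ j)⁻¹))

theorem IsNonneg.letterWeight_nonneg {p : MonoidAlgebra ℝ G} (hp : IsNonneg p) (s x : G)
    (n j : ℕ) : 0 ≤ letterWeight p s x n j :=
  mul_nonneg (Nat.cast_nonneg _) (mul_nonneg (pow_nonneg (hp s) _) ((hp.erase s).pow _ _))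

/-- The binomial theorem for `p = single s (p s) + p.erase s`, which needs commutativity of `G`. -/
theorem sum_letterWeight (p : MonoidAlgebra ℝ G) (s x : G) (n : ℕ) :
    ∑ j ∈ Finset.range (n + 1), letterWeight p s x n j = (p ^ n).coeff x := by
  conv_rhs => rw [← MonoidAlgebra.single_add_erase s p, add_pow]
  rw [MonoidAlgebra.coeff_sum, Finsupp.finsetSum_apply]
  refine Finset.sum_congr rfl fun j _ => ?_
  rw [MonoidAlgebra.single_pow, ← nsmul_eq_mul', MonoidAlgebra.coeff_smul_apply,
    MonoidAlgebra.coeff_single_mul_apply, nsmul_eq_mul, letterWeight, mul_comm x]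

/-- By exchangeability of the letters, the mean frequency of `s` is the share of the words that
start with `s`. In formulas, `j * choose (n+1) j = (n+1) * choose n (j-1)`. -/
theorem sum_mul_letterWeight (p : MonoidAlgebra ℝ G) (s x : G) (n : ℕ) :
    ∑ j ∈ Finset.range (n + 1 + 1), (j : ℝ) / (n + 1 : ℕ) * letterWeight p s x (n + 1) j
      = p.coeff s * (p ^ n).coeff (x * s⁻¹) := by
  rw [Finset.sum_range_succ', ← sum_letterWeight p s, Finset.mul_sum]
  simp only [Nat.cast_zero, zero_div, zero_mul, add_zero]
  refine Finset.sum_congr rfl fun j _ => ?_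
  have h : ((n : ℝ) + 1) * n.choose j = (n + 1).choose (j + 1) * (j + 1) := by
    exact_mod_cast Nat.add_one_mul_choose_eq n j
  have h2 : (j + 1 : ℝ) / (n + 1) * (n + 1).choose (j + 1) = n.choose j := by
    field_simp
    linarith
  simp only [letterWeight]
  rw [Nat.add_sub_add_right, show x * (s ^ (j + 1))⁻¹ = x * s⁻¹ * (s ^ j)⁻¹ by
    rw [pow_succ', mul_inv, mul_assoc], ← h2]
  push_cast
  ring

/-- The array of `letterWeight` at the identity, without the binomial coefficients. -/
def letterArray (p : MonoidAlgebra ℝ G) (s : G) (j k : ℕ) : ℝ :=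
  p.coeff s ^ j * ((p.erase s) ^ k).coeff (s ^ j)⁻¹

theorem arrangementWeight_letterArray (p : MonoidAlgebra ℝ G) (s : G) (j k : ℕ) :
    arrangementWeight (letterArray p s) j k = letterWeight p s 1 (j + k) j := by
  simp [arrangementWeight, letterArray, letterWeight]

theorem IsNonneg.isSupermultiplicative_letterArray {p : MonoidAlgebra ℝ G} (hp : IsNonneg p)
    (s : G) : IsSupermultiplicative (letterArray p s) where
  nonneg j k := mul_nonneg (pow_nonneg (hp s) _) ((hp.erase s).pow _ _)
  one_le := by simp [letterArray]
  mul_le j k j' k' := by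
    have h := (hp.erase s).pow_coeff_mul_le k k' (s ^ j)⁻¹ (s ^ j')⁻¹
    rw [← mul_inv, ← pow_add] at h
    unfold letterArray
    calc _ = p.coeff s ^ (j + j') * (((p.erase s) ^ k).coeff (s ^ j)⁻¹ *
          ((p.erase s) ^ k').coeff (s ^ j')⁻¹) := by ring
      _ ≤ _ := mul_le_mul_of_nonneg_left h (pow_nonneg (hp s) _)

/-- Appending a word with product `x⁻¹` turns words with product `x` into words with product `1`,
whose weights form the supermultiplicative array. -/
theorem IsNonneg.letterWeight_mul_le {p : MonoidAlgebra ℝ G} (hp : IsNonneg p) (s x : G)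
    {l j₀ n j : ℕ} (hj₀ : j₀ ≤ l) (hj : j ≤ n) :
    letterWeight p s x⁻¹ l j₀ * letterWeight p s x n j
      ≤ arrangementWeight (letterArray p s) (j + j₀) (n - j + (l - j₀)) := by
  have h := (hp.erase s).pow_coeff_mul_le (n - j) (l - j₀) (x * (s ^ j)⁻¹) (x⁻¹ * (s ^ j₀)⁻¹)
  rw [show x * (s ^ j)⁻¹ * (x⁻¹ * (s ^ j₀)⁻¹) = (s ^ (j + j₀))⁻¹ by
    rw [pow_add, mul_inv, mul_mul_mul_comm, mul_inv_cancel, one_mul]] at h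
  have hc := choose_mul_choose_le j (n - j) j₀ (l - j₀)
  rw [Nat.add_sub_cancel' hj, Nat.add_sub_cancel' hj₀] at hc
  have hc' : (n.choose j : ℝ) * l.choose j₀
      ≤ ((j + j₀ + (n - j + (l - j₀))).choose (j + j₀) : ℝ) := by exact_mod_cast hc
  unfold arrangementWeight letterArray letterWeight
  calc _ = ((n.choose j : ℝ) * l.choose j₀) * (p.coeff s ^ (j + j₀) *
        (((p.erase s) ^ (n - j)).coeff (x * (s ^ j)⁻¹) *
          ((p.erase s) ^ (l - j₀)).coeff (x⁻¹ * (s ^ j₀)⁻¹))) := by ring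
    _ ≤ _ := mul_le_mul hc' (mul_le_mul_of_nonneg_left h (pow_nonneg (hp s) _))
        (mul_nonneg (pow_nonneg (hp s) _)
          (mul_nonneg ((hp.erase s).pow _ _) ((hp.erase s).pow _ _))) (by positivity)

/-! ### Growth rate of the return probabilities and removal of one letter -/

/-- `γ` is the exponential growth rate of the return probabilities. -/
structure IsGrowthRate (p : MonoidAlgebra ℝ G) (γ : ℝ) : Prop where
  pos : 0 < γ
  le_one : γ ≤ 1
  le_pow : ∀ n, (p ^ n).coeff 1 ≤ γ ^ n
  ge_pow : ∀ δ > 0, ∀ᶠ n : ℕ in atTop, (γ * Real.exp (-δ)) ^ n ≤ (p ^ n).coeff 1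

theorem exists_isGrowthRate {p : MonoidAlgebra ℝ G} (hp : IsProbability p)
    (haper : IsAperiodic p) : ∃ γ, IsGrowthRate p γ := by
  obtain ⟨K, hK⟩ := exists_forall_ge_return_pos hp haper
  obtain ⟨γ, h1, h2, h3, h4⟩ := exists_growth_rate (u := fun n => (p ^ n).coeff 1)
    (fun n => hp.isNonneg.pow n 1) (fun n => hp.pow_coeff_le_one n 1)
    (fun m n => by simpa using hp.isNonneg.pow_coeff_mul_le m n 1 1) (by simp) hK
  exact ⟨γ, h1, h2, h3, h4⟩

theorem IsGrowthRate.eventually_le_coeff {p : MonoidAlgebra ℝ G} {γ : ℝ} (hγ : IsGrowthRate p γ)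
    (hp : IsProbability p) (hgen : GeneratesAsSemigroup p) (x : G) {δ : ℝ} (hδ : 0 < δ) :
    ∀ᶠ n : ℕ in atTop, (γ * Real.exp (-δ)) ^ n ≤ (p ^ n).coeff x := by
  obtain ⟨l, -, hl⟩ := exists_pow_coeff_pos hp hgen x
  have h1 := (tendsto_sub_atTop_nat l).eventually (hγ.ge_pow (δ / 2) (by positivity))
  have hγ0 := hγ.pos
  have he : γ * Real.exp (-(δ / 2)) ≤ 1 :=
    mul_le_one₀ hγ.le_one (Real.exp_pos _).le (Real.exp_le_one_iff.2 (by linarith))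
  filter_upwards [h1, eventually_pow_exp_le hγ.pos hδ hl, eventually_ge_atTop l] with n h1 h2 h3
  refine h2.trans ?_
  have h4 := hp.isNonneg.pow_coeff_mul_le l (n - l) x 1
  rw [mul_one, Nat.add_sub_cancel' h3] at h4
  refine le_trans (mul_le_mul_of_nonneg_left (le_trans ?_ h1) hl.le) h4
  exact pow_le_pow_of_le_one (by positivity) he (Nat.sub_le _ _)

/-- The quotient is the mean frequency of `s` divided by `p s`. The limit is the same for all `x`
because `α` comes from the array at the identity. -/
theorem exists_removal_limit {p : MonoidAlgebra ℝ G} {γ : ℝ} (hγ : IsGrowthRate p γ)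
    (hp : IsProbability p) (hgen : GeneratesAsSemigroup p) {s : G} (hs : 0 < p.coeff s) :
    ∃ β : ℝ, ∀ x, Tendsto (fun n : ℕ => (p ^ n).coeff (x * s⁻¹) / (p ^ (n + 1)).coeff x)
      atTop (𝓝 β) := by
  have hR := hp.isNonneg.isSupermultiplicative_letterArray s
  have hle : ∀ j k, arrangementWeight (letterArray p s) j k ≤ γ ^ (j + k) := by
    intro j k
    rw [arrangementWeight_letterArray]
    refine le_trans ?_ (hγ.le_pow (j + k))
    rw [← sum_letterWeight p s]
    exact Finset.single_le_sum (f := letterWeight p s 1 (j + k))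
      (fun i _ => hp.isNonneg.letterWeight_nonneg s 1 _ i) (Finset.mem_range.2 (by omega))
  have hγ0 := hγ.pos
  -- Only `n + 1` terms sum to the return probability, so one of them has nearly full exponential
  -- size.
  have hne : ∀ δ > 0, ∃ j k, 0 < j + k ∧
      (γ * Real.exp (-δ)) ^ (j + k) ≤ arrangementWeight (letterArray p s) j k := by
    intro δ hδ
    have hr : |Real.exp (-(δ / 2))| < 1 := by
      rw [abs_of_pos (Real.exp_pos _), Real.exp_lt_one_iff]
      linarith
    have h3 := (tendsto_pow_const_mul_const_pow_of_abs_lt_one 1 hr).add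
      (tendsto_pow_const_mul_const_pow_of_abs_lt_one 0 hr)
    simp only [add_zero] at h3
    obtain ⟨n, hn1, hn2, hn3⟩ := ((h3.eventually_lt_const one_pos).and
      ((hγ.ge_pow (δ / 2) (by positivity)).and (eventually_gt_atTop 0))).exists
    by_contra! hcon
    rw [← sum_letterWeight p s] at hn2
    have h4 : ∑ j ∈ Finset.range (n + 1), letterWeight p s 1 n j
        ≤ (n + 1) * (γ * Real.exp (-δ)) ^ n := by
      refine (Finset.sum_le_card_nsmul _ _ ((γ * Real.exp (-δ)) ^ n) fun j hj => ?_).trans_eq ?_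
      · have hjn : j ≤ n := by simpa [Nat.lt_succ_iff] using hj
        have := hcon j (n - j) (by omega)
        rw [arrangementWeight_letterArray, Nat.add_sub_cancel' hjn] at this
        exact this.le
      · simp
    have h5 : (γ * Real.exp (-δ)) ^ n
        = Real.exp (-(δ / 2)) ^ n * (γ * Real.exp (-(δ / 2))) ^ n := by
      rw [← mul_pow, mul_left_comm, ← Real.exp_add]
      ring_nf
    have h6 : 0 < (γ * Real.exp (-(δ / 2))) ^ n := by positivity
    rw [h5] at h4
    nlinarith
  obtain ⟨α, hα⟩ := hR.exists_frequency hγ.pos hle hne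
  refine ⟨α / p.coeff s, fun x => ?_⟩
  obtain ⟨l, -, hl⟩ := exists_pow_coeff_pos hp hgen x⁻¹
  rw [← sum_letterWeight p s] at hl
  obtain ⟨j₀, hj₀, hc⟩ := Finset.exists_lt_of_sum_lt (f := fun _ => (0 : ℝ)) (by simpa using hl)
  have hj₀l : j₀ ≤ l := by simpa [Nat.lt_succ_iff] using hj₀
  have hmain := tendsto_mean_frequency hγ.pos hα
    (B := letterWeight p s x) (hp.isNonneg.letterWeight_nonneg s x) hc
    (fun n j hj => hp.isNonneg.letterWeight_mul_le s x hj₀l hj)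
    (fun δ hδ => by
      simp only [sum_letterWeight]
      exact hγ.eventually_le_coeff hp hgen x hδ)
  have h2 := ((tendsto_add_atTop_iff_nat 1).2 hmain).div_const (p.coeff s)
  refine h2.congr fun n => ?_
  rw [sum_mul_letterWeight, sum_letterWeight]
  field_simp

end GroupAlgebra

/-! ### The ratio limit theorem -/

section RatioLimit

variable {G : Type*} [CommGroup G] {p : MonoidAlgebra ℝ G} {γ : ℝ}

theorem IsGrowthRate.eventually_coeff_pos (hγ : IsGrowthRate p γ)
    (hp : IsProbability p) (hgen : GeneratesAsSemigroup p) (x : G) :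
    ∀ᶠ n : ℕ in atTop, 0 < (p ^ n).coeff x := by
  filter_upwards [hγ.eventually_le_coeff hp hgen x one_pos] with n hn
  have := hγ.pos
  exact lt_of_lt_of_le (by positivity) hn

/-- Removing a word of length `k` with product `y` multiplies the transition probabilities by `β`
in the limit. -/
def HasRemovalLimit (p : MonoidAlgebra ℝ G) (k : ℕ) (y : G) (β : ℝ) : Prop :=
  ∀ x, Tendsto (fun n : ℕ => (p ^ n).coeff (x * y⁻¹) / (p ^ (n + k)).coeff x) atTop (𝓝 β)

/-- Removal limits multiply because `HasRemovalLimit` quantifies over all base points `x`, so it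
applies again at `x * y⁻¹`. -/
theorem HasRemovalLimit.mul (hγ : IsGrowthRate p γ) (hp : IsProbability p)
    (hgen : GeneratesAsSemigroup p) {k k' : ℕ} {y y' : G} {β β' : ℝ}
    (h : HasRemovalLimit p k y β) (h' : HasRemovalLimit p k' y' β') :
    HasRemovalLimit p (k + k') (y * y') (β * β') := by
  intro x
  have h1 := (h x).comp (tendsto_add_atTop_nat k')
  have h2 := h' (x * y⁻¹)
  have hne := (tendsto_add_atTop_nat k').eventually
    (hγ.eventually_coeff_pos hp hgen (x * y⁻¹))
  refine (h1.mul h2).congr' ?_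
  filter_upwards [hne] with n hn
  simp only [Function.comp]
  rw [mul_inv, ← mul_assoc, show n + (k + k') = n + k' + k by ring, mul_comm,
    div_mul_div_cancel₀ hn.ne']

theorem exists_hasRemovalLimit (hγ : IsGrowthRate p γ) (hp : IsProbability p)
    (hgen : GeneratesAsSemigroup p) {k : ℕ} {y : G} (hy : 0 < (p ^ k).coeff y) :
    ∃ β, HasRemovalLimit p k y β := by
  classical
  induction k generalizing y with
  | zero =>
    have hy1 : y = 1 := by
      by_contra hne
      rw [pow_zero, MonoidAlgebra.one_def, MonoidAlgebra.coeff_single, Finsupp.single_apply,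
        if_neg (Ne.symm hne)] at hy
      exact hy.false
    refine ⟨1, fun x => tendsto_const_nhds.congr' ?_⟩
    filter_upwards [hγ.eventually_coeff_pos hp hgen x] with n hn
    rw [hy1, inv_one, mul_one, add_zero, div_self hn.ne']
  | succ k ih =>
    rw [pow_succ', coeff_mul_eq_sum] at hy
    obtain ⟨s, hs, hsy⟩ := Finset.exists_lt_of_sum_lt (f := fun _ => (0 : ℝ)) (by simpa using hy)
    have hs0 : 0 < p.coeff s := (hp.nonneg s).lt_of_ne' (Finsupp.mem_support_iff.1 hs)
    obtain ⟨β, hβ⟩ := exists_removal_limit hγ hp hgen hs0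
    obtain ⟨β', hβ'⟩ := ih ((mul_pos_iff_of_pos_left hs0).1 hsy)
    refine ⟨β * β', ?_⟩
    have := HasRemovalLimit.mul hγ hp hgen (k := 1) hβ hβ'
    rwa [mul_inv_cancel_left, add_comm] at this

theorem HasRemovalLimit.nonneg (hp : IsProbability p) {k : ℕ} {y : G} {β : ℝ}
    (h : HasRemovalLimit p k y β) : 0 ≤ β :=
  ge_of_tendsto' (h 1) fun _ => div_nonneg (hp.isNonneg.pow _ _) (hp.isNonneg.pow _ _)

/-- If removing a cycle of length `k` had limit `0`, the return probability would eventually at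
least double every `k` steps and exceed `1`. -/
theorem HasRemovalLimit.ne_zero_of_cycle (hγ : IsGrowthRate p γ) (hp : IsProbability p)
    (hgen : GeneratesAsSemigroup p) {k : ℕ} {β : ℝ} (h : HasRemovalLimit p k 1 β) : β ≠ 0 := by
  rintro rfl
  have h1 := (h 1).eventually_lt_const (show (0 : ℝ) < 1 / 2 by norm_num)
  obtain ⟨N, hN⟩ := eventually_atTop.1 (h1.and (hγ.eventually_coeff_pos hp hgen 1))
  have hstep : ∀ n ≥ N, 2 * (p ^ n).coeff 1 ≤ (p ^ (n + k)).coeff 1 := by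
    intro n hn
    have h2 := (hN n hn).1
    rw [inv_one, mul_one, div_lt_iff₀ (hN (n + k) (by omega)).2] at h2
    linarith
  have hiter : ∀ m : ℕ, 2 ^ m * (p ^ N).coeff 1 ≤ (p ^ (N + m * k)).coeff 1 := by
    intro m
    induction m with
    | zero => simp
    | succ m ih =>
      have := hstep (N + m * k) (by omega)
      rw [add_mul, one_mul, ← add_assoc, pow_succ]
      linarith
  obtain ⟨m, hm⟩ := pow_unbounded_of_one_lt (1 / (p ^ N).coeff 1) one_lt_two
  rw [div_lt_iff₀ (hN N le_rfl).2] at hm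
  exact absurd (hm.trans_le ((hiter m).trans (hp.pow_coeff_le_one _ _))) (lt_irrefl _)

/-- A word with product `y⁻¹` completes `y` to a cycle, whose limit is nonzero and is a multiple of
`β`. -/
theorem HasRemovalLimit.pos (hγ : IsGrowthRate p γ) (hp : IsProbability p)
    (hgen : GeneratesAsSemigroup p) {k : ℕ} {y : G} {β : ℝ}
    (h : HasRemovalLimit p k y β) : 0 < β := by
  refine (h.nonneg hp).lt_of_ne' fun h0 => ?_
  obtain ⟨l, -, hl⟩ := exists_pow_coeff_pos hp hgen y⁻¹
  obtain ⟨β', hβ'⟩ := exists_hasRemovalLimit hγ hp hgen hl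
  have := h.mul hγ hp hgen hβ'
  rw [mul_inv_cancel] at this
  exact this.ne_zero_of_cycle hγ hp hgen (by rw [h0, zero_mul])

theorem tendsto_log_div {u : ℕ → ℝ} {γ : ℝ} (hγ : 0 < γ) (h : ∀ n, u n ≤ γ ^ n)
    (h' : ∀ δ > 0, ∀ᶠ n : ℕ in atTop, (γ * Real.exp (-δ)) ^ n ≤ u n) :
    Tendsto (fun n : ℕ => Real.log (u n) / n) atTop (𝓝 (Real.log γ)) := by
  rw [Metric.tendsto_nhds]
  intro ε hε
  filter_upwards [h' (ε / 2) (by positivity), eventually_gt_atTop 0] with n hn hn0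
  have hn0' : (0 : ℝ) < n := by exact_mod_cast hn0
  have hpos : 0 < (γ * Real.exp (-(ε / 2))) ^ n := by positivity
  have h1 := Real.log_le_log hpos hn
  have h2 := Real.log_le_log (hpos.trans_le hn) (h n)
  rw [Real.log_pow, Real.log_mul hγ.ne' (Real.exp_pos _).ne', Real.log_exp] at h1
  rw [Real.log_pow] at h2
  rw [Real.dist_eq, abs_lt]
  constructor
  · have : Real.log γ + -(ε / 2) ≤ Real.log (u n) / n := by
      rw [le_div_iff₀ hn0']; linarith
    linarith
  · have : Real.log (u n) / n ≤ Real.log γ := by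
      rw [div_le_iff₀ hn0']; linarith
    linarith

theorem tendsto_root {u : ℕ → ℝ} {γ : ℝ} (hγ : 0 < γ) (h : ∀ n, u n ≤ γ ^ n)
    (h' : ∀ δ > 0, ∀ᶠ n : ℕ in atTop, (γ * Real.exp (-δ)) ^ n ≤ u n) :
    Tendsto (fun n : ℕ => u n ^ (1 / (n : ℝ))) atTop (𝓝 γ) := by
  have h1 := (Real.continuous_exp.tendsto _).comp (tendsto_log_div hγ h h')
  rw [Real.exp_log hγ] at h1
  refine h1.congr' ?_
  filter_upwards [h' 1 one_pos] with n hn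
  have : 0 < u n := lt_of_lt_of_le (by positivity) hn
  rw [Function.comp, Real.rpow_def_of_pos this, mul_one_div]

theorem tendsto_log_div_of_ratio {u : ℕ → ℝ} {r : ℝ} (hr : 0 < r) (hu : ∀ᶠ n in atTop, 0 < u n)
    (h : Tendsto (fun n => u (n + 1) / u n) atTop (𝓝 r)) :
    Tendsto (fun n : ℕ => Real.log (u n) / n) atTop (𝓝 (Real.log r)) := by
  have h1 : Tendsto (fun n => Real.log (u (n + 1)) - Real.log (u n)) atTop (𝓝 (Real.log r)) := by
    refine ((Real.continuousAt_log hr.ne').tendsto.comp h).congr' ?_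
    filter_upwards [hu, (tendsto_add_atTop_nat 1).eventually hu] with n h2 h3
    exact Real.log_div h3.ne' h2.ne'
  have h2 := h1.cesaro.add (tendsto_const_div_atTop_nhds_zero_nat (Real.log (u 0)))
  rw [add_zero] at h2
  refine h2.congr fun n => ?_
  rw [Finset.sum_range_sub (fun n => Real.log (u n))]
  ring

/-- By aperiodicity there are cycles of lengths `K` and `K + 1`. The quotient of their removal
limits is the limit of the one-step ratio, and Cesàro averaging of logarithms identifies it with the
growth rate. -/
theorem tendsto_return_ratio (hγ : IsGrowthRate p γ) (hp : IsProbability p)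
    (hgen : GeneratesAsSemigroup p) :
    Tendsto (fun n : ℕ => (p ^ (n + 1)).coeff 1 / (p ^ n).coeff 1) atTop (𝓝 γ) := by
  have hpos := hγ.eventually_coeff_pos hp hgen 1
  obtain ⟨K, hK⟩ := eventually_atTop.1 hpos
  obtain ⟨β, hβ⟩ := exists_hasRemovalLimit hγ hp hgen (hK K le_rfl)
  obtain ⟨β', hβ'⟩ := exists_hasRemovalLimit hγ hp hgen (hK (K + 1) (by omega))
  have hβ0 := hβ.pos hγ hp hgen
  have hβ'0 := hβ'.pos hγ hp hgen
  have h1 := ((hβ 1).comp (tendsto_add_atTop_nat 1)).div (hβ' 1) hβ'0.ne'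
  have h2 : Tendsto (fun n : ℕ => (p ^ (n + 1)).coeff 1 / (p ^ n).coeff 1) atTop
      (𝓝 (β / β')) := by
    refine h1.congr' ?_
    filter_upwards [(tendsto_add_atTop_nat (K + 1)).eventually hpos] with n hn
    simp only [Function.comp, Pi.div_apply, inv_one, mul_one]
    rw [show n + 1 + K = n + (K + 1) by ring, div_div_div_cancel_right₀ hn.ne']
  have h3 := tendsto_nhds_unique (tendsto_log_div_of_ratio (div_pos hβ0 hβ'0) hpos h2)
    (tendsto_log_div hγ.pos hγ.le_pow hγ.ge_pow)
  rwa [Real.log_injOn_pos (div_pos hβ0 hβ'0) hγ.pos h3] at h2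

theorem tendsto_return_ratio_add (hγ : IsGrowthRate p γ) (hp : IsProbability p)
    (hgen : GeneratesAsSemigroup p) (k : ℕ) :
    Tendsto (fun n : ℕ => (p ^ (n + k)).coeff 1 / (p ^ n).coeff 1) atTop (𝓝 (γ ^ k)) := by
  have hpos := hγ.eventually_coeff_pos hp hgen 1
  induction k with
  | zero =>
    refine tendsto_const_nhds.congr' ?_
    filter_upwards [hpos] with n hn
    rw [pow_zero, add_zero, div_self hn.ne']
  | succ k ih =>
    rw [pow_succ']
    refine (((tendsto_return_ratio hγ hp hgen).comp (tendsto_add_atTop_nat k)).mul ih).congr' ?_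
    filter_upwards [(tendsto_add_atTop_nat k).eventually hpos] with n hn
    rw [Function.comp, div_mul_div_cancel₀ hn.ne', add_assoc]

/-- `h(x) = lim p^{*n}(x) / p^{*n}(e)`, a positive multiplicative function. -/
structure IsRatioLimit (p : MonoidAlgebra ℝ G) (h : G → ℝ) : Prop where
  pos : ∀ x, 0 < h x
  map_mul : ∀ x y, h (x * y) = h x * h y
  tendsto : ∀ x, Tendsto (fun n : ℕ => (p ^ n).coeff x / (p ^ n).coeff 1) atTop (𝓝 (h x))

theorem exists_isRatioLimit (hγ : IsGrowthRate p γ) (hp : IsProbability p)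
    (hgen : GeneratesAsSemigroup p) : ∃ h, IsRatioLimit p h := by
  have hpos := hγ.eventually_coeff_pos hp hgen
  have hγ0 := hγ.pos
  have hex : ∀ x, ∃ l : ℝ, 0 < l ∧
      Tendsto (fun n : ℕ => (p ^ n).coeff x / (p ^ n).coeff 1) atTop (𝓝 l) := by
    intro x
    obtain ⟨k, -, hk⟩ := exists_pow_coeff_pos hp hgen x
    obtain ⟨β, hβ⟩ := exists_hasRemovalLimit hγ hp hgen hk
    have hβ0 := hβ.pos hγ hp hgen
    refine ⟨β⁻¹ / γ ^ k, by positivity, (tendsto_add_atTop_iff_nat k).1 ?_⟩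
    refine (((hβ x).inv₀ hβ0.ne').div (tendsto_return_ratio_add hγ hp hgen k)
      (by positivity)).congr' ?_
    filter_upwards [hpos 1] with n hn
    rw [Pi.div_apply, mul_inv_cancel, inv_div, div_div_div_cancel_right₀ hn.ne']
  choose h h0 hlim using hex
  refine ⟨h, h0, fun x y => ?_, hlim⟩
  obtain ⟨k, -, hk⟩ := exists_pow_coeff_pos hp hgen y⁻¹
  obtain ⟨β, hβ⟩ := exists_hasRemovalLimit hγ hp hgen hk
  -- Removing a word with product `y⁻¹` is multiplication by `y`. Its limit `β` is independent of
  -- `z`, so comparing `z = x` with `z = 1` makes `h` multiplicative.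
  have hval : ∀ z, β = h (z * y) / γ ^ k / h z := by
    intro z
    have h1 : Tendsto (fun n => (p ^ n).coeff (z * y) / (p ^ (n + k)).coeff z) atTop (𝓝 β) := by
      simpa using hβ z
    refine tendsto_nhds_unique h1 ?_
    refine (((hlim (z * y)).div (tendsto_return_ratio_add hγ hp hgen k) (by positivity)).div
      ((hlim z).comp (tendsto_add_atTop_nat k)) (h0 z).ne').congr' ?_
    filter_upwards [hpos 1, (tendsto_add_atTop_nat k).eventually (hpos 1)] with n hn hn'
    simp only [Pi.div_apply, Function.comp]
    rw [div_div_div_cancel_right₀ hn.ne', div_div_div_cancel_right₀ hn'.ne']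
  have h1 : h 1 = 1 := by
    refine tendsto_nhds_unique (hlim 1) (tendsto_const_nhds.congr' ?_)
    filter_upwards [hpos 1] with n hn
    rw [div_self hn.ne']
  have h2 := (hval x).symm.trans (hval 1)
  rw [one_mul, h1, div_one, div_eq_iff (h0 x).ne', div_mul_eq_mul_div,
    div_left_inj' (by positivity)] at h2
  rw [h2, mul_comm]

namespace IsRatioLimit

variable {h : G → ℝ}

theorem map_one (hh : IsRatioLimit p h) : h 1 = 1 := by
  have := hh.map_mul 1 1
  rw [mul_one] at this
  exact (mul_eq_left₀ (hh.pos 1).ne').1 this.symm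

theorem map_inv (hh : IsRatioLimit p h) (x : G) : h x⁻¹ = (h x)⁻¹ := by
  refine eq_inv_of_mul_eq_one_left ?_
  rw [← hh.map_mul, inv_mul_cancel, hh.map_one]

theorem tendsto_div (hh : IsRatioLimit p h) (hγ : IsGrowthRate p γ) (hp : IsProbability p)
    (hgen : GeneratesAsSemigroup p) (x y : G) :
    Tendsto (fun n : ℕ => (p ^ n).coeff (x * y) / (p ^ n).coeff y) atTop (𝓝 (h x)) := by
  have h1 := (hh.tendsto (x * y)).div (hh.tendsto y) (hh.pos y).ne'
  rw [hh.map_mul, mul_div_cancel_right₀ _ (hh.pos y).ne'] at h1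
  refine h1.congr' ?_
  filter_upwards [hγ.eventually_coeff_pos hp hgen 1] with n hn
  rw [Pi.div_apply, div_div_div_cancel_right₀ hn.ne']

/-- The limit of the one-step recursion for `p^{*(n+1)}(e)`, divided by `p^{*n}(e)`. Together with
multiplicativity of `h` it is the harmonicity of `1 / h`. -/
theorem sum_eq (hh : IsRatioLimit p h) (hγ : IsGrowthRate p γ) (hp : IsProbability p)
    (hgen : GeneratesAsSemigroup p) : ∑ s ∈ p.coeff.support, p.coeff s * h s⁻¹ = γ := by
  refine tendsto_nhds_unique ?_ (tendsto_return_ratio hγ hp hgen)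
  refine (tendsto_finsetSum p.coeff.support
    fun s _ => (hh.tendsto s⁻¹).const_mul (p.coeff s)).congr fun n => ?_
  rw [pow_succ', coeff_mul_eq_sum, Finset.sum_div]
  simp [mul_div_assoc]

theorem isRatioLimitFunction (hh : IsRatioLimit p h) (hγ : IsGrowthRate p γ)
    (hp : IsProbability p) (hgen : GeneratesAsSemigroup p) :
    IsRatioLimitFunction p γ fun x => 1 / h x where
  pos x := one_div_pos.2 (hh.pos x)
  harmonic x := by
    rw [← hh.sum_eq hγ hp hgen, Finset.sum_mul]
    refine Finset.sum_congr rfl fun s _ => ?_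
    rw [hh.map_mul, hh.map_inv, one_div, mul_inv]
    ring
  ratio_limit x := by simpa using hh.tendsto x

end IsRatioLimit

theorem IsRatioLimitFunction.eq {Φ Ψ : G → ℝ} {γ γ' : ℝ} (hΦ : IsRatioLimitFunction p γ Φ)
    (hΨ : IsRatioLimitFunction p γ' Ψ) : Φ = Ψ := by
  ext x
  have := tendsto_nhds_unique (hΦ.ratio_limit x) (hΨ.ratio_limit x)
  rwa [one_div, one_div, inv_inj] at this

end RatioLimit

/-! ### The density as an element of the group algebra -/

section Density

theorem IsNonneg.coeff_single_le {G : Type*} {p : MonoidAlgebra ℝ G} (hp : IsNonneg p)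
    (s x : G) :
    (MonoidAlgebra.single s (p.coeff s)).coeff x ≤ p.coeff x := by
  classical
  rw [MonoidAlgebra.coeff_single, Finsupp.single_apply]
  split_ifs with h
  · rw [h]
  · exact hp x

variable {G : Type*} [CommGroup G]

/-- The total weight of the words of length `n` with first letter `A` and last letter `a`, as an
element of the group algebra. -/
def wordElem (p : MonoidAlgebra ℝ G) (A a : G) : ℕ → MonoidAlgebra ℝ G
  | 0 => 0
  | 1 => open Classical in if A = a then MonoidAlgebra.single A (p.coeff A) else 0
  | n + 2 => MonoidAlgebra.single (A * a) (p.coeff A * p.coeff a) * p ^ n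

theorem sum_letter_single (p : MonoidAlgebra ℝ G) :
    ∑ s : Letter p, MonoidAlgebra.single (s : G) (p.coeff s) = p := by
  rw [Finset.sum_coe_sort p.coeff.support fun s => MonoidAlgebra.single s (p.coeff s)]
  exact MonoidAlgebra.sum_coeff_single p

theorem single_wordProd {p : MonoidAlgebra ℝ G} {n : ℕ} (w : Fin n → Letter p) :
    MonoidAlgebra.single (wordProd w) (∏ i, p.coeff (w i : G))
      = ∏ i, MonoidAlgebra.single (w i : G) (p.coeff (w i : G)) := by
  rw [wordProd, List.prod_ofFn]
  simp

open Classical in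
-- The conditions on the end letters are conditions on single positions, so the sum over words
-- factors over positions. For `n = 1` both fall on the same position.
theorem sum_words_eq_prod (p : MonoidAlgebra ℝ G) (A a : Letter p) {n : ℕ} (hn : 0 < n) :
    ∑ w : Fin n → Letter p with w ∈ words p A a n,
      MonoidAlgebra.single (wordProd w) (∏ i, p.coeff (w i : G))
    = ∏ i : Fin n, ∑ s : Letter p with (i.val = 0 → s = A) ∧ (i.val = n - 1 → s = a),
      MonoidAlgebra.single (s : G) (p.coeff s) := by
  simp only [single_wordProd]
  rw [Finset.prod_univ_sum (fun i : Fin n =>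
    ({s : Letter p | (i.val = 0 → s = A) ∧ (i.val = n - 1 → s = a)} : Finset (Letter p)))]
  refine Finset.sum_congr ?_ fun _ _ => rfl
  ext w
  rw [Finset.mem_filter_univ, Fintype.mem_piFinset]
  simp only [Finset.mem_filter_univ]
  constructor
  · rintro ⟨h, h1, h2⟩ i
    exact ⟨fun hi => by rw [← h1]; congr 1; exact Fin.ext hi,
      fun hi => by rw [← h2]; congr 1; exact Fin.ext hi⟩
  · intro h
    exact ⟨hn, (h _).1 rfl, (h _).2 rfl⟩

open Classical in
theorem sum_words (p : MonoidAlgebra ℝ G) (A a : Letter p) {n : ℕ} (hn : 0 < n) :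
    ∑ w : Fin n → Letter p with w ∈ words p A a n,
      MonoidAlgebra.single (wordProd w) (∏ i, p.coeff (w i : G)) = wordElem p A a n := by
  rw [sum_words_eq_prod p A a hn]
  match n, hn with
  | 1, _ =>
    rw [Fin.prod_univ_one, wordElem]
    split_ifs with h
    · have hAa : A = a := Subtype.ext h
      simp [← hAa, Finset.sum_filter]
    · refine Finset.sum_eq_zero fun s hs => absurd ?_ h
      have hs' := (Finset.mem_filter.1 hs).2
      rw [← hs'.1 rfl, ← hs'.2 rfl]
  | n + 2, _ =>
    rw [Fin.prod_univ_succ, Fin.prod_univ_castSucc]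
    have hm : ∀ i : Fin n, ¬ i.val = n := fun i => i.isLt.ne
    simp only [Fin.val_zero, Fin.val_succ, Fin.val_castSucc, Fin.val_last, hm, Nat.add_eq_zero_iff,
      one_ne_zero, and_false, false_imp_iff, true_imp_iff, true_and, and_true, Finset.filter_true,
      Nat.add_right_cancel_iff, Finset.sum_filter, Finset.sum_ite_eq',
      Finset.mem_univ, if_true, sum_letter_single, Finset.prod_const, Finset.card_univ,
      Fintype.card_fin, (Nat.succ_ne_zero _).symm, show n + 2 - 1 = n + 1 from rfl]
    rw [wordElem, ← MonoidAlgebra.single_mul_single]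
    ring

/-- `φ_{c;≤N}[t]` as an element of the group algebra. -/
def densityElem (p : MonoidAlgebra ℝ G) (A a : G) (c : ℕ → ℝ) (N : ℕ) (t : ℝ) :
    MonoidAlgebra ℝ G :=
  ∑ n ∈ Finset.Icc 1 N, ((t ^ n)⁻¹ * c n) • wordElem p A a n

theorem density_eq (p : MonoidAlgebra ℝ G) (A a : Letter p) (c : ℕ → ℝ) (N : ℕ) (t : ℝ) :
    density p A a c N t = (densityElem p A a c N t).coeff := by
  classical
  ext g
  rw [density, densityElem, MonoidAlgebra.coeff_sum, Finsupp.finsetSum_apply]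
  refine Finset.sum_congr rfl fun n hn => ?_
  rw [MonoidAlgebra.coeff_smul_apply, smul_eq_mul, ← sum_words p A a (Finset.mem_Icc.1 hn).1,
    MonoidAlgebra.coeff_sum, Finsupp.finsetSum_apply, ← Finset.filter_filter, Finset.sum_filter]
  congr 1
  refine Finset.sum_congr (by congr) fun w _ => ?_
  rw [MonoidAlgebra.coeff_single, Finsupp.single_apply]

open Classical in
theorem deltaOne_apply (x : G) : deltaOne G x = if x = 1 then 1 else 0 := by
  rw [deltaOne, lp.single_apply, Pi.single_apply]

theorem leftRegular_apply (g : G) (f : ell2 G) (x : G) : leftRegular G g f x = f (g⁻¹ * x) := rfl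

theorem convVec_deltaOne_apply {φ : G → ℝ} (hφ : φ.support.Finite) (x : G) :
    convVec φ (deltaOne G) x = φ x := by
  classical
  have h : ∀ y ∉ hφ.toFinset, φ y • leftRegular G y (deltaOne G) = 0 := by
    intro y hy
    rw [Set.Finite.mem_toFinset, Function.notMem_support] at hy
    rw [hy, zero_smul]
  rw [convVec, tsum_eq_sum h, lp.coeFn_sum, Finset.sum_apply]
  simp only [lp.coeFn_smul, Pi.smul_apply, leftRegular_apply, deltaOne_apply, inv_mul_eq_one,
    smul_eq_mul, mul_ite, mul_one, mul_zero]
  rw [Finset.sum_ite_eq' hφ.toFinset x φ]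
  split_ifs with h0
  · rfl
  · rw [Set.Finite.mem_toFinset, Function.notMem_support] at h0
    exact h0.symm

theorem inner_deltaOne (f : ell2 G) : inner ℝ f (deltaOne G) = f 1 := by
  classical
  rw [deltaOne, lp.inner_single_right]
  simp

theorem inner_convVec_density (p : MonoidAlgebra ℝ G) (A a : Letter p) (c : ℕ → ℝ) (N : ℕ)
    (t : ℝ) : inner ℝ (convVec (density p A a c N t) (deltaOne G)) (deltaOne G)
      = (densityElem p A a c N t).coeff 1 := by
  rw [inner_deltaOne, density_eq, convVec_deltaOne_apply (Finsupp.hasFiniteSupport _)]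

theorem tsum_inner_mul_density (p : MonoidAlgebra ℝ G) (A a : Letter p) (c : ℕ → ℝ) (N : ℕ)
    (t : ℝ) : ∑' h : G, inner ℝ (leftRegular G h (deltaOne G)) (deltaOne G) *
      density p A a c N t h = (densityElem p A a c N t).coeff 1 := by
  classical
  rw [tsum_eq_single 1]
  · rw [inner_deltaOne, leftRegular_apply, deltaOne_apply, density_eq]
    simp
  · intro h hh
    rw [inner_deltaOne, leftRegular_apply, deltaOne_apply, mul_one, if_neg (by simpa using hh),
      zero_mul]

/-- Substituting `x ↦ g x` turns `∑ φ(g⁻¹ x) φ(x⁻¹)` into `∑ φ(x) φ(x⁻¹ g⁻¹)`, a convolution square.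
-/
theorem coeffStar_eq (p : MonoidAlgebra ℝ G) (A a : Letter p) (c : ℕ → ℝ) (N : ℕ)
    (t : ℝ) (g : G) : coeffStar p A a c N t g
      = (densityElem p A a c N t * densityElem p A a c N t).coeff g⁻¹ := by
  rw [coeffStar, density_eq, lp.inner_eq_tsum, coeff_mul_eq_sum]
  set D := densityElem p (A : G) a c N t
  have hadj : (adj D.coeff).support.Finite :=
    ((Finsupp.hasFiniteSupport D.coeff).preimage inv_injective.injOn).subset fun x hx => hx
  rw [← (Equiv.mulLeft g).tsum_eq, tsum_eq_sum (s := D.coeff.support)]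
  · refine Finset.sum_congr rfl fun x _ => ?_
    rw [Equiv.coe_mulLeft, leftRegular_apply, inv_mul_cancel_left,
      convVec_deltaOne_apply (Finsupp.hasFiniteSupport _), convVec_deltaOne_apply hadj, adj,
      mul_inv_rev]
    simp [mul_comm]
  · intro x hx
    rw [Equiv.coe_mulLeft, leftRegular_apply, inv_mul_cancel_left,
      convVec_deltaOne_apply (Finsupp.hasFiniteSupport _), Finsupp.notMem_support_iff.1 hx,
      inner_zero_left]

theorem coeff_densityElem (p : MonoidAlgebra ℝ G) (A a : G) (c : ℕ → ℝ) (N : ℕ) (t : ℝ) (x : G) :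
    (densityElem p A a c N t).coeff x
      = ∑ n ∈ Finset.Icc 1 N, (t ^ n)⁻¹ * c n * (wordElem p A a n).coeff x := by
  rw [densityElem, MonoidAlgebra.coeff_sum, Finsupp.finsetSum_apply]
  rfl

theorem coeff_densityElem_mul_self (p : MonoidAlgebra ℝ G) (A a : G) (c : ℕ → ℝ) (N : ℕ) (t : ℝ)
    (x : G) : (densityElem p A a c N t * densityElem p A a c N t).coeff x
      = ∑ q ∈ Finset.Icc 1 N ×ˢ Finset.Icc 1 N, (t ^ (q.1 + q.2))⁻¹ * (c q.1 * c q.2) *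
          (wordElem p A a q.1 * wordElem p A a q.2).coeff x := by
  rw [densityElem, Finset.sum_mul_sum, ← Finset.sum_product', MonoidAlgebra.coeff_sum,
    Finsupp.finsetSum_apply]
  refine Finset.sum_congr rfl fun q _ => ?_
  rw [smul_mul_smul_comm, MonoidAlgebra.coeff_smul_apply, smul_eq_mul, pow_add, mul_inv]
  ring

/-! ### Estimates for the words with prescribed first and last letter -/

section Words

variable {p : MonoidAlgebra ℝ G}

theorem IsNonneg.wordElem (hp : IsNonneg p) (A a : G) : ∀ n, IsNonneg (wordElem p A a n)
  | 0 => fun _ => le_rfl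
  | 1 => by
    classical
    rw [RandomWalkDensity.wordElem]
    split_ifs
    · exact .single (hp A)
    · exact fun _ => le_rfl
  | n + 2 => (IsNonneg.single (mul_nonneg (hp A) (hp a))).mul (hp.pow n)

theorem coeff_mul_le_coeff_mul {f f' g g' : MonoidAlgebra ℝ G} (hf : IsNonneg f)
    (hg' : IsNonneg g') (hff' : ∀ x, f.coeff x ≤ f'.coeff x) (hgg' : ∀ x, g.coeff x ≤ g'.coeff x)
    (x : G) : (f * g).coeff x ≤ (f' * g').coeff x := by
  have h1 : (f * g).coeff x ≤ (f * g').coeff x := by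
    rw [coeff_mul_eq_sum, coeff_mul_eq_sum]
    exact Finset.sum_le_sum fun y _ => mul_le_mul_of_nonneg_left (hgg' _) (hf y)
  refine h1.trans ?_
  rw [mul_comm f, mul_comm f', coeff_mul_eq_sum, coeff_mul_eq_sum]
  exact Finset.sum_le_sum fun y _ => mul_le_mul_of_nonneg_left (hff' _) (hg' y)

theorem IsNonneg.coeff_wordElem_le (hp : IsNonneg p) (A a : G) :
    ∀ n x, (RandomWalkDensity.wordElem p A a n).coeff x ≤ (p ^ n).coeff x
  | 0, x => hp.pow 0 x
  | 1, x => by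
    classical
    rw [RandomWalkDensity.wordElem, pow_one]
    split_ifs
    · exact hp.coeff_single_le A x
    · exact hp x
  | n + 2, x => by
    rw [RandomWalkDensity.wordElem, add_comm, pow_add, sq, ← MonoidAlgebra.single_mul_single]
    refine coeff_mul_le_coeff_mul ((IsNonneg.single (hp A)).mul (.single (hp a))) (hp.pow n) ?_
      (fun _ => le_rfl) x
    exact coeff_mul_le_coeff_mul (.single (hp A)) hp (hp.coeff_single_le A) (hp.coeff_single_le a)

theorem IsNonneg.coeff_wordElem_mul_le (hp : IsNonneg p) (A a : G) (i j : ℕ) (x : G) :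
    (RandomWalkDensity.wordElem p A a i * RandomWalkDensity.wordElem p A a j).coeff x
      ≤ (p ^ (i + j)).coeff x := by
  rw [pow_add]
  exact coeff_mul_le_coeff_mul (hp.wordElem A a i) (hp.pow j) (hp.coeff_wordElem_le A a i)
    (hp.coeff_wordElem_le A a j) x

theorem wordElem_mul_wordElem (p : MonoidAlgebra ℝ G) (A a : G) (i j : ℕ) :
    wordElem p A a (i + 2) * wordElem p A a (j + 2)
      = MonoidAlgebra.single (A * a * (A * a)) (p.coeff A * p.coeff a * (p.coeff A * p.coeff a)) *
        p ^ (i + j) := by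
  rw [wordElem, wordElem, ← MonoidAlgebra.single_mul_single (A * a), pow_add]
  ring

/-- Taking `C = 0` when `A ≠ a` treats one-letter words uniformly with the longer ones. -/
theorem exists_wordElem_one_mul (p : MonoidAlgebra ℝ G) (hp : IsNonneg p) (A a : G) :
    ∃ B C, 0 ≤ C ∧ ∀ j, wordElem p A a 1 * wordElem p A a (j + 2)
      = MonoidAlgebra.single B C * p ^ j := by
  classical
  by_cases h : A = a
  · refine ⟨A * (A * a), p.coeff A * (p.coeff A * p.coeff a),
      mul_nonneg (hp A) (mul_nonneg (hp A) (hp a)), fun j => ?_⟩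
    rw [wordElem, if_pos h, wordElem, ← mul_assoc, MonoidAlgebra.single_mul_single]
  · refine ⟨1, 0, le_rfl, fun j => ?_⟩
    rw [wordElem, if_neg h, MonoidAlgebra.single_zero, zero_mul, zero_mul]

variable {γ : ℝ} {h : G → ℝ}

/-- The ratio limit in a form without division, so that `C = 0` is admitted. -/
theorem IsRatioLimit.exists_abs_sub_le (hh : IsRatioLimit p h) (hγ : IsGrowthRate p γ)
    (hp : IsProbability p) (hgen : GeneratesAsSemigroup p) (B y : G) {C ε : ℝ} (hC : 0 ≤ C)
    (hε : 0 < ε) : ∃ n₀, ∀ n ≥ n₀,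
      |(MonoidAlgebra.single B C * p ^ n).coeff y - h y * (MonoidAlgebra.single B C * p ^ n).coeff 1|
        ≤ ε * (MonoidAlgebra.single B C * p ^ n).coeff 1 := by
  obtain ⟨n₀, hn₀⟩ := eventually_atTop.1 (((hh.tendsto_div hγ hp hgen y B⁻¹).eventually
    (Metric.ball_mem_nhds _ hε)).and (hγ.eventually_coeff_pos hp hgen B⁻¹))
  refine ⟨n₀, fun n hn => ?_⟩
  obtain ⟨h1, h2⟩ := hn₀ n hn
  rw [MonoidAlgebra.coeff_single_mul_apply, MonoidAlgebra.coeff_single_mul_apply, mul_one,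
    mul_comm B⁻¹]
  rw [Real.dist_eq] at h1
  have h3 : C * (p ^ n).coeff (y * B⁻¹) - h y * (C * (p ^ n).coeff B⁻¹)
      = ((p ^ n).coeff (y * B⁻¹) / (p ^ n).coeff B⁻¹ - h y) * (C * (p ^ n).coeff B⁻¹) := by
    field_simp
  rw [h3, abs_mul, abs_of_nonneg (mul_nonneg hC h2.le)]
  exact mul_le_mul_of_nonneg_right h1.le (mul_nonneg hC h2.le)

theorem IsRatioLimit.exists_abs_wordElem_sub_le (hh : IsRatioLimit p h) (hγ : IsGrowthRate p γ)
    (hp : IsProbability p) (hgen : GeneratesAsSemigroup p) (A a y : G) {ε : ℝ} (hε : 0 < ε) :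
    ∃ n₀, ∀ i j, n₀ ≤ i + j →
      |(wordElem p A a i * wordElem p A a j).coeff y
          - h y * (wordElem p A a i * wordElem p A a j).coeff 1|
        ≤ ε * (wordElem p A a i * wordElem p A a j).coeff 1 := by
  have hpn := hp.isNonneg
  obtain ⟨B, C, hC, hBC⟩ := exists_wordElem_one_mul p hpn A a
  obtain ⟨n₁, h₁⟩ := hh.exists_abs_sub_le hγ hp hgen B y hC hε
  obtain ⟨n₂, h₂⟩ := hh.exists_abs_sub_le hγ hp hgen (A * a * (A * a)) y
    (C := p.coeff A * p.coeff a * (p.coeff A * p.coeff a))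
    (mul_nonneg (mul_nonneg (hpn A) (hpn a)) (mul_nonneg (hpn A) (hpn a))) hε
  -- The end letters use up three or four of the `i + j` positions. The bound also rules out `i = j
  -- = 1`.
  refine ⟨n₁ + n₂ + 4, fun i j hij => ?_⟩
  match i, j with
  | 0, j => simp [wordElem]
  | i, 0 => simp [wordElem]
  | 1, 1 => omega
  | 1, j + 2 =>
    rw [hBC]
    exact h₁ j (by omega)
  | i + 2, 1 =>
    rw [mul_comm, hBC]
    exact h₁ i (by omega)
  | i + 2, j + 2 =>
    rw [wordElem_mul_wordElem]
    exact h₂ (i + j) (by omega)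

end Words

end Density

/-! ### The convergence parameter and the limits defining `Υ` -/

section Convergence

variable {G : Type*} [CommGroup G] {p : MonoidAlgebra ℝ G} {γ : ℝ} {h : G → ℝ}

theorem IsNonneg.monotone_coeff_densityElem (hp : IsNonneg p) (A a : G) {c : ℕ → ℝ}
    (hc : ∀ n, 0 < c n) {t : ℝ} (ht : 0 < t) (x : G) :
    Monotone fun N => (densityElem p A a c N t).coeff x := by
  intro N M hNM
  simp only [coeff_densityElem]
  refine Finset.sum_le_sum_of_subset_of_nonneg (Finset.Icc_subset_Icc_right hNM) fun n _ _ => ?_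
  have := hc n
  exact mul_nonneg (by positivity) (hp.wordElem A a n x)

theorem IsNonneg.monotone_coeff_densityElem_mul_self (hp : IsNonneg p) (A a : G) {c : ℕ → ℝ}
    (hc : ∀ n, 0 < c n) {t : ℝ} (ht : 0 < t) (x : G) :
    Monotone fun N => (densityElem p A a c N t * densityElem p A a c N t).coeff x := by
  intro N M hNM
  simp only [coeff_densityElem_mul_self]
  refine Finset.sum_le_sum_of_subset_of_nonneg (Finset.product_subset_product
    (Finset.Icc_subset_Icc_right hNM) (Finset.Icc_subset_Icc_right hNM)) fun q _ _ => ?_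
  have := hc q.1
  have := hc q.2
  exact mul_nonneg (by positivity) ((hp.wordElem A a q.1).mul (hp.wordElem A a q.2) x)

theorem coeff_densityElem_zero (A a : G) (c : ℕ → ℝ) (t : ℝ) (x : G) :
    (densityElem p A a c 0 t).coeff x = 0 := by
  rw [coeff_densityElem]
  simp

theorem coeff_densityElem_zero_mul_self (A a : G) (c : ℕ → ℝ) (t : ℝ) (x : G) :
    (densityElem p A a c 0 t * densityElem p A a c 0 t).coeff x = 0 := by
  rw [coeff_densityElem_mul_self]
  simp

theorem IsGrowthRate.coeff_densityElem_le (hγ : IsGrowthRate p γ) (hp : IsProbability p)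
    (A a : G) {c : ℕ → ℝ} (hc : ∀ n, 0 < c n) {t : ℝ} (ht : 0 < t)
    (hs : Summable fun n => c n * (γ / t) ^ n) (N : ℕ) :
    (densityElem p A a c N t).coeff 1 ≤ ∑' n, c n * (γ / t) ^ n := by
  have hγ0 := hγ.pos
  rw [coeff_densityElem]
  refine (Finset.sum_le_sum fun n _ => ?_).trans
    (hs.sum_le_tsum (Finset.Icc 1 N) fun n _ => by have := hc n; positivity)
  have hcn := hc n
  have h1 := (hp.isNonneg.coeff_wordElem_le A a n 1).trans (hγ.le_pow n)
  calc (t ^ n)⁻¹ * c n * (wordElem p A a n).coeff 1 ≤ (t ^ n)⁻¹ * c n * γ ^ n := by gcongr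
    _ = c n * (γ / t) ^ n := by rw [div_pow]; ring

theorem IsGrowthRate.coeff_densityElem_mul_self_le (hγ : IsGrowthRate p γ) (hp : IsProbability p)
    (A a : G) {c : ℕ → ℝ} (hc : ∀ n, 0 < c n) {t : ℝ} (ht : 0 < t)
    (hs : Summable fun n => c n * (γ / t) ^ n) (N : ℕ) :
    (densityElem p A a c N t * densityElem p A a c N t).coeff 1
      ≤ (∑' n, c n * (γ / t) ^ n) ^ 2 := by
  have hγ0 := hγ.pos
  have hterm : ∀ n, 0 ≤ c n * (γ / t) ^ n := fun n => by have := hc n; positivity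
  rw [coeff_densityElem_mul_self]
  calc _ ≤ ∑ q ∈ Finset.Icc 1 N ×ˢ Finset.Icc 1 N,
        (c q.1 * (γ / t) ^ q.1) * (c q.2 * (γ / t) ^ q.2) := by
        refine Finset.sum_le_sum fun q _ => ?_
        have h1 := hc q.1
        have h2 := hc q.2
        have h3 := (hp.isNonneg.coeff_wordElem_mul_le A a q.1 q.2 1).trans (hγ.le_pow _)
        calc _ ≤ (t ^ (q.1 + q.2))⁻¹ * (c q.1 * c q.2) * γ ^ (q.1 + q.2) := by gcongr
          _ = _ := by rw [div_pow, div_pow, pow_add, pow_add]; field_simp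
    _ = (∑ n ∈ Finset.Icc 1 N, c n * (γ / t) ^ n) ^ 2 := by
        rw [sq, Finset.sum_mul_sum, ← Finset.sum_product']
    _ ≤ _ := pow_le_pow_left₀ (Finset.sum_nonneg fun n _ => hterm n)
        (hs.sum_le_tsum _ fun n _ => hterm n) 2

theorem letter_pos (hp : IsProbability p) (A : Letter p) : 0 < p.coeff (A : G) :=
  (hp.nonneg A).lt_of_ne' (Finsupp.mem_support_iff.1 A.2)

/-- Above `γ` the sums are dominated by a geometric series. Below `γ` a single late term already
exceeds any bound. -/
theorem IsGrowthRate.convParam_eq (hγ : IsGrowthRate p γ) (hp : IsProbability p)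
    (hgen : GeneratesAsSemigroup p) (A a : Letter p) : convParam p A a = γ := by
  have hγ0 := hγ.pos
  simp only [convParam, tsum_inner_mul_density]
  have hmem : ∀ t, γ < t → t ∈ {t : ℝ | 0 < t ∧ BddAbove (Set.range fun N : ℕ =>
      (densityElem p (A : G) a (fun _ => 1) N t).coeff 1)} := by
    intro t ht
    have ht0 := hγ0.trans ht
    have hs : Summable fun n : ℕ => (1 : ℝ) * (γ / t) ^ n := by
      simp only [one_mul]
      exact summable_geometric_of_lt_one (by positivity) ((div_lt_one ht0).2 ht)
    refine ⟨ht0, ∑' n : ℕ, (1 : ℝ) * (γ / t) ^ n, ?_⟩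
    rintro _ ⟨N, rfl⟩
    exact hγ.coeff_densityElem_le hp A a (fun _ => one_pos) ht0 hs N
  refine le_antisymm (le_of_forall_gt_imp_ge_of_dense fun t ht =>
    csInf_le ⟨0, fun t ht => ht.1.le⟩ (hmem t ht)) (le_csInf ⟨γ + 1, hmem _ (by linarith)⟩ ?_)
  rintro t ⟨ht0, b, hb⟩
  by_contra! htγ
  -- With this choice `γ e^{-δ} / t` is the square root of `γ / t`, hence greater than `1`.
  set δ := Real.log (γ / t) / 2 with hδ
  have hlog : 0 < Real.log (γ / t) := Real.log_pos ((one_lt_div ht0).2 htγ)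
  have hδ0 : 0 < δ := by positivity
  have hg : 1 < γ * Real.exp (-δ) / t := by
    have h1 : Real.exp (-Real.log (γ / t)) < Real.exp (-δ) := Real.exp_lt_exp.2 (by linarith)
    rw [Real.exp_neg, Real.exp_log (by positivity), inv_div, div_lt_iff₀ hγ0] at h1
    rw [one_lt_div ht0]
    linarith
  have hC : 0 < p.coeff (A : G) * p.coeff (a : G) := mul_pos (letter_pos hp A) (letter_pos hp a)
  obtain ⟨n, hn1, hn2⟩ := ((hγ.eventually_le_coeff hp hgen ((A : G) * a)⁻¹ hδ0).and
    ((tendsto_pow_atTop_atTop_of_one_lt hg).eventually_gt_atTop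
      (b * t ^ 2 / (p.coeff (A : G) * p.coeff (a : G))))).exists
  have hle := hb ⟨n + 2, rfl⟩
  simp only [coeff_densityElem, mul_one] at hle
  have hsingle := Finset.single_le_sum (s := Finset.Icc 1 (n + 2))
    (f := fun n => (t ^ n)⁻¹ * (wordElem p (A : G) a n).coeff 1)
    (fun i _ => mul_nonneg (by positivity) (hp.isNonneg.wordElem A a i 1))
    (Finset.mem_Icc.2 ⟨by omega, le_rfl⟩ : n + 2 ∈ Finset.Icc 1 (n + 2))
  have h3 := hsingle.trans hle
  simp only [wordElem, MonoidAlgebra.coeff_single_mul_apply, mul_one] at h3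
  rw [inv_mul_le_iff₀ (by positivity)] at h3
  rw [div_pow, div_lt_div_iff₀ hC (by positivity)] at hn2
  have h4 := mul_le_mul_of_nonneg_right hn1 hC.le
  rw [pow_add] at h3
  linarith

/-- The pairs with `i + j < n₀` are finitely many, and their weights for `t ≥ γ` are at most those
at `t = γ`. Hence `K` depends neither on `t` nor on `N`, which permits the limit in `N` followed by
`t ↓ γ`. -/
theorem IsRatioLimit.exists_abs_densityElem_sub_le (hh : IsRatioLimit p h) (hγ : IsGrowthRate p γ)
    (hp : IsProbability p) (hgen : GeneratesAsSemigroup p) (A a y : G) {c : ℕ → ℝ}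
    (hc : ∀ n, 0 < c n) {ε : ℝ} (hε : 0 < ε) :
    ∃ K, ∀ t, γ ≤ t → ∀ N,
      |(densityElem p A a c N t * densityElem p A a c N t).coeff y
          - h y * (densityElem p A a c N t * densityElem p A a c N t).coeff 1|
        ≤ ε * (densityElem p A a c N t * densityElem p A a c N t).coeff 1 + K := by
  obtain ⟨n₀, hn₀⟩ := hh.exists_abs_wordElem_sub_le hγ hp hgen A a y hε
  have hγ0 := hγ.pos
  set M : ℕ × ℕ → G → ℝ := fun q x => (wordElem p A a q.1 * wordElem p A a q.2).coeff x with hM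
  have hM0 : ∀ q x, 0 ≤ M q x := fun q x => (hp.isNonneg.wordElem A a _).mul
    (hp.isNonneg.wordElem A a _) x
  set f : ℕ × ℕ → ℝ := fun q => (γ ^ (q.1 + q.2))⁻¹ * (c q.1 * c q.2) * |M q y - h y * M q 1|
  have hf0 : ∀ q, 0 ≤ f q := fun q => by
    have := hc q.1
    have := hc q.2
    positivity
  refine ⟨∑ q ∈ Finset.range n₀ ×ˢ Finset.range n₀, f q, fun t ht N => ?_⟩
  have ht0 := hγ0.trans_le ht
  set s := Finset.Icc 1 N ×ˢ Finset.Icc 1 N with hs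
  rw [coeff_densityElem_mul_self, coeff_densityElem_mul_self, Finset.mul_sum,
    ← Finset.sum_sub_distrib]
  have hterm : ∀ q ∈ s,
      |(t ^ (q.1 + q.2))⁻¹ * (c q.1 * c q.2) * M q y
          - h y * ((t ^ (q.1 + q.2))⁻¹ * (c q.1 * c q.2) * M q 1)|
        ≤ ε * ((t ^ (q.1 + q.2))⁻¹ * (c q.1 * c q.2) * M q 1)
          + if q.1 + q.2 < n₀ then f q else 0 := by
    intro q _
    have h1 := hc q.1
    have h2 := hc q.2
    have h3 : 0 ≤ (t ^ (q.1 + q.2))⁻¹ * (c q.1 * c q.2) := by positivity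
    rw [show (t ^ (q.1 + q.2))⁻¹ * (c q.1 * c q.2) * M q y
          - h y * ((t ^ (q.1 + q.2))⁻¹ * (c q.1 * c q.2) * M q 1)
        = (t ^ (q.1 + q.2))⁻¹ * (c q.1 * c q.2) * (M q y - h y * M q 1) by ring, abs_mul,
      abs_of_nonneg h3]
    split_ifs with hq
    · have h4 : (t ^ (q.1 + q.2))⁻¹ ≤ (γ ^ (q.1 + q.2))⁻¹ := by gcongr
      have h5 : 0 ≤ ε * ((t ^ (q.1 + q.2))⁻¹ * (c q.1 * c q.2) * M q 1) :=
        mul_nonneg hε.le (mul_nonneg h3 (hM0 q 1))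
      have h6 : (t ^ (q.1 + q.2))⁻¹ * (c q.1 * c q.2) * |M q y - h y * M q 1| ≤ f q :=
        mul_le_mul_of_nonneg_right (mul_le_mul_of_nonneg_right h4 (by positivity)) (abs_nonneg _)
      linarith
    · have := mul_le_mul_of_nonneg_left (hn₀ q.1 q.2 (by omega)) h3
      simp only [hM]
      linarith
  refine (Finset.abs_sum_le_sum_abs _ _).trans ((Finset.sum_le_sum hterm).trans ?_)
  rw [Finset.sum_add_distrib, ← Finset.mul_sum, ← Finset.sum_filter]
  refine add_le_add le_rfl (Finset.sum_le_sum_of_subset_of_nonneg (fun q hq => ?_) fun q _ _ => hf0 q)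
  have := (Finset.mem_filter.1 hq).2
  exact Finset.mem_product.2 ⟨Finset.mem_range.2 (by omega), Finset.mem_range.2 (by omega)⟩

theorem exists_tendsto_densityElem (hh : IsRatioLimit p h)
    (hγ : IsGrowthRate p γ) (hp : IsProbability p) (hgen : GeneratesAsSemigroup p) (A a y : G)
    {c : ℕ → ℝ} (hc : ∀ n, 0 < c n) {t F : ℝ} (ht : γ < t)
    (hF : Tendsto (fun N => (densityElem p A a c N t * densityElem p A a c N t).coeff 1)
      atTop (𝓝 F)) :
    ∃ L, Tendsto (fun N => (densityElem p A a c N t * densityElem p A a c N t).coeff y)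
      atTop (𝓝 L) := by
  obtain ⟨K, hK⟩ := hh.exists_abs_densityElem_sub_le hγ hp hgen A a y hc one_pos
  have ht0 := hγ.pos.trans ht
  have hmono1 := hp.isNonneg.monotone_coeff_densityElem_mul_self A a hc ht0 1
  refine ⟨_, tendsto_atTop_ciSup (hp.isNonneg.monotone_coeff_densityElem_mul_self A a hc ht0 y)
    ⟨h y * F + F + K, ?_⟩⟩
  rintro _ ⟨N, rfl⟩
  have h1 := (abs_le.1 (hK t ht.le N)).2
  have h2 := hmono1.ge_of_tendsto hF N
  have h3 := mul_le_mul_of_nonneg_left h2 (hh.pos y).le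
  simp only at h2 h3 ⊢
  linarith

theorem tendsto_quotient (hp : IsProbability p) (A a y : G) {c : ℕ → ℝ} (hc : ∀ n, 0 < c n)
    {t F L : ℝ} (ht : 0 < t)
    (hF : Tendsto (fun N => (densityElem p A a c N t * densityElem p A a c N t).coeff 1)
      atTop (𝓝 F))
    (hL : Tendsto (fun N => (densityElem p A a c N t * densityElem p A a c N t).coeff y)
      atTop (𝓝 L)) :
    Tendsto (fun N => (densityElem p A a c N t * densityElem p A a c N t).coeff y /
      (densityElem p A a c N t * densityElem p A a c N t).coeff 1) atTop (𝓝 (L / F)) := by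
  -- `F` may vanish when `t` is not close to `γ`. By monotonicity all denominators are then `0`, and
  -- both the quotients and `L / F` have the default value `0`.
  rcases eq_or_ne F 0 with rfl | hF0
  · have hmono := hp.isNonneg.monotone_coeff_densityElem_mul_self A a hc ht 1
    have hz : ∀ N, (densityElem p A a c N t * densityElem p A a c N t).coeff 1 = 0 := by
      intro N
      refine le_antisymm (hmono.ge_of_tendsto hF N) ?_
      rw [← coeff_densityElem_zero_mul_self (p := p) A a c t 1]
      exact hmono (Nat.zero_le N)
    simp only [hz, div_zero]
    exact tendsto_const_nhds
  · exact hL.div hF hF0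

theorem upsilonStar_spec (hh : IsRatioLimit p h) (hγ : IsGrowthRate p γ) (hp : IsProbability p)
    (hgen : GeneratesAsSemigroup p) (A a : Letter p) {c : ℕ → ℝ}
    (hc : IsDivergenceWeight p A a c) {t : ℕ → ℝ} (ht : ∀ k, convParam p A a < t k)
    (htlim : Tendsto t atTop (𝓝 (convParam p A a))) (g : G) :
    (∀ k : ℕ, ∃ L : ℝ, Tendsto (fun N : ℕ => quotStar p A a c N (t k) g) atTop (𝓝 L)) ∧
      Tendsto (fun k => innerLimit p A a c (t k) g) atTop (𝓝 (h g⁻¹)) := by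
  have hcpos := hc.slow.pos
  obtain ⟨E, F, -, hF, hFtop, -⟩ := hc.divergence
  have hFt := hFtop.comp (tendsto_nhdsWithin_iff.2 ⟨htlim, Eventually.of_forall ht⟩)
  rw [hγ.convParam_eq hp hgen] at ht hF
  simp only [coeffStar_eq, inv_one] at hF
  choose L hL using fun k => exists_tendsto_densityElem hh hγ hp hgen A a g⁻¹ hcpos (ht k)
    (hF _ (ht k))
  have hq : ∀ k, Tendsto (fun N : ℕ => quotStar p A a c N (t k) g) atTop
      (𝓝 (L k / F (t k))) := by
    intro k
    simp only [quotStar, coeffStar_eq, inv_one]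
    exact tendsto_quotient hp A a _ hcpos (hγ.pos.trans (ht k)) (hF _ (ht k)) (hL k)
  refine ⟨fun k => ⟨_, hq k⟩, ?_⟩
  have hinner : (fun k => innerLimit p A a c (t k) g) = fun k => L k / F (t k) :=
    funext fun k => (hq k).limUnder_eq
  rw [hinner, Metric.tendsto_nhds]
  intro ε hε
  obtain ⟨K, hK⟩ := hh.exists_abs_densityElem_sub_le hγ hp hgen A a g⁻¹ hcpos (half_pos hε)
  have hLF : ∀ k, |L k - h g⁻¹ * F (t k)| ≤ ε / 2 * F (t k) + K := fun k =>
    le_of_tendsto_of_tendsto' (((hL k).sub ((hF _ (ht k)).const_mul _)).abs)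
      (((hF _ (ht k)).const_mul _).add_const K) (hK (t k) (ht k).le)
  filter_upwards [hFt.eventually_gt_atTop 0, hFt.eventually_gt_atTop (K / (ε / 2))] with k h1 h2
  simp only [Function.comp] at h1 h2
  rw [div_lt_iff₀ (half_pos hε)] at h2
  rw [Real.dist_eq, div_sub' h1.ne', abs_div, abs_of_pos h1, div_lt_iff₀ h1, mul_comm (F (t k))]
  have := hLF k
  linarith

end Convergence

/-! ### Existence of a divergence weight -/

theorem SlowlyIncreasing.tendsto_ratio_add {c : ℕ → ℝ} (hc : SlowlyIncreasing c) (k : ℕ) :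
    Tendsto (fun n => c (n + k) / c n) atTop (𝓝 1) := by
  induction k with
  | zero => exact tendsto_const_nhds.congr fun n => (div_self (hc.pos n).ne').symm
  | succ k ih =>
    rw [← one_mul (1 : ℝ)]
    refine ((hc.ratio.comp (tendsto_add_atTop_nat k)).mul ih).congr fun n => ?_
    rw [Function.comp, div_mul_div_cancel₀ (hc.pos _).ne', add_assoc]

theorem SlowlyIncreasing.summable_mul_pow {c : ℕ → ℝ} (hc : SlowlyIncreasing c) {r : ℝ}
    (h0 : 0 < r) (h1 : r < 1) : Summable fun n => c n * r ^ n := by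
  refine summable_of_ratio_test_tendsto_lt_one h1
    (Eventually.of_forall fun n => (mul_pos (hc.pos n) (pow_pos h0 n)).ne') ?_
  have := hc.ratio.mul_const r
  rw [one_mul] at this
  refine this.congr fun n => ?_
  have h2 := hc.pos n
  have h3 := hc.pos (n + 1)
  rw [Real.norm_of_nonneg (by positivity), Real.norm_of_nonneg (by positivity), pow_succ]
  field_simp

section Weight

variable {G : Type*} [CommGroup G] {p : MonoidAlgebra ℝ G} {γ : ℝ} {h : G → ℝ}

theorem IsRatioLimit.tendsto_shift_div (hh : IsRatioLimit p h) (hγ : IsGrowthRate p γ)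
    (hp : IsProbability p) (hgen : GeneratesAsSemigroup p) (k : ℕ) (x y : G) :
    Tendsto (fun n : ℕ => (p ^ (n + k)).coeff x / (p ^ n).coeff y) atTop
      (𝓝 (h x * γ ^ k / h y)) := by
  have hpos := hγ.eventually_coeff_pos hp hgen 1
  refine ((((hh.tendsto x).comp (tendsto_add_atTop_nat k)).mul
    (tendsto_return_ratio_add hγ hp hgen k)).div (hh.tendsto y) (hh.pos y).ne').congr' ?_
  filter_upwards [hpos, (tendsto_add_atTop_nat k).eventually hpos] with n h1 h2
  rw [Pi.div_apply, Function.comp, div_mul_div_cancel₀ h2.ne', div_div_div_cancel_right₀ h1.ne']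

/-- This gives `E / F → 0`. For a fixed large `i`, the `n`-th term of the density is at most `ε`
times the term `(i + 2, n - (i + 2))` of its square: the two coefficients have bounded ratio, `c n /
c (n - (i + 2))` tends to `1`, and `c (i + 2)` is a spare large factor. -/
theorem exists_coeff_densityElem_le (hh : IsRatioLimit p h) (hγ : IsGrowthRate p γ)
    (hp : IsProbability p) (hgen : GeneratesAsSemigroup p) (A a : Letter p) {c : ℕ → ℝ}
    (hc : SlowlyIncreasing c) {ε : ℝ} (hε : 0 < ε) :
    ∃ K, 0 ≤ K ∧ ∀ t, γ ≤ t → ∀ N, (densityElem p (A : G) a c N t).coeff 1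
      ≤ ε * (densityElem p (A : G) a c N t * densityElem p (A : G) a c N t).coeff 1 + K := by
  have hγ0 := hγ.pos
  set C := p.coeff (A : G) * p.coeff (a : G) with hCdef
  have hC : 0 < C := mul_pos (letter_pos hp A) (letter_pos hp a)
  set B : G := (A : G) * a with hB
  have hlim := fun k => hh.tendsto_shift_div hγ hp hgen k B⁻¹ (B * B)⁻¹
  -- The factor `2` bounds the ratio of the shifted weights, and the rest bounds the ratio of
  -- transition probabilities, which differ by two steps. One factor `C` is left over from the
  -- second pair of end letters.
  obtain ⟨i, hi⟩ := ((tendsto_add_atTop_nat 2).eventually (hc.tendsto_atTop.eventually_ge_atTop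
    (2 * (h B⁻¹ * γ ^ 2 / h (B * B)⁻¹ + 1) / (ε * C)))).exists
  set Λ := h B⁻¹ * γ ^ 2 / h (B * B)⁻¹ + 1 with hΛ
  have hΛ0 : 0 < Λ := by
    have := hh.pos B⁻¹
    have := hh.pos (B * B)⁻¹
    positivity
  rw [div_le_iff₀ (by positivity)] at hi
  set W := wordElem p (A : G) a with hW
  have hW0 : ∀ n x, 0 ≤ (W n).coeff x := fun n x => hp.isNonneg.wordElem A a n x
  have hWW0 : ∀ m n x, 0 ≤ (W m * W n).coeff x := fun m n x =>
    (hp.isNonneg.wordElem A a m).mul (hp.isNonneg.wordElem A a n) x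
  obtain ⟨m₀, hm₀⟩ : ∃ m₀, ∀ m ≥ m₀,
      c (m + (i + 4)) * (W (m + (i + 4))).coeff 1
        ≤ ε * (c (i + 2) * c (m + 2) * (W (i + 2) * W (m + 2)).coeff 1) := by
    have h1 := ((hlim 2).eventually_lt_const
      (show h B⁻¹ * γ ^ 2 / h (B * B)⁻¹ < Λ by rw [hΛ]; linarith))
    have h2 := (tendsto_add_atTop_nat i).eventually
      (h1.and (hγ.eventually_coeff_pos hp hgen (B * B)⁻¹))
    have h3 := (tendsto_add_atTop_nat 2).eventually
      ((hc.tendsto_ratio_add (i + 2)).eventually_lt_const one_lt_two)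
    obtain ⟨m₀, hm₀⟩ := eventually_atTop.1 (h2.and h3)
    refine ⟨m₀, fun m hm => ?_⟩
    obtain ⟨⟨h4, h5⟩, h6⟩ := hm₀ m hm
    rw [div_lt_iff₀ h5] at h4
    rw [div_lt_iff₀ (hc.pos _), show m + 2 + (i + 2) = m + (i + 4) by ring] at h6
    have e1 : (W (m + (i + 4))).coeff 1 = C * (p ^ (m + i + 2)).coeff B⁻¹ := by
      rw [hW, show m + (i + 4) = m + i + 2 + 2 by ring, wordElem,
        MonoidAlgebra.coeff_single_mul_apply, mul_one]
    have e2 : (W (i + 2) * W (m + 2)).coeff 1 = C * C * (p ^ (m + i)).coeff (B * B)⁻¹ := by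
      rw [hW, wordElem_mul_wordElem, MonoidAlgebra.coeff_single_mul_apply, mul_one, add_comm i]
    rw [e1, e2]
    have hcm := hc.pos (m + 2)
    calc c (m + (i + 4)) * (C * (p ^ (m + i + 2)).coeff B⁻¹)
        ≤ (2 * c (m + 2)) * (C * (Λ * (p ^ (m + i)).coeff (B * B)⁻¹)) :=
          mul_le_mul h6.le (mul_le_mul_of_nonneg_left h4.le hC.le)
            (mul_nonneg hC.le (hp.isNonneg.pow _ _)) (by positivity)
      _ = (2 * Λ) * (c (m + 2) * C * (p ^ (m + i)).coeff (B * B)⁻¹) := by ring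
      _ ≤ (c (i + 2) * (ε * C)) * (c (m + 2) * C * (p ^ (m + i)).coeff (B * B)⁻¹) := by
          gcongr
      _ = _ := by ring
  set n₀ := m₀ + (i + 4) with hn₀
  refine ⟨∑ n ∈ Finset.range n₀, (γ ^ n)⁻¹ * c n * (W n).coeff 1,
    Finset.sum_nonneg fun n _ => by have := hc.pos n; have := hW0 n 1; positivity,
    fun t ht N => ?_⟩
  have ht0 := hγ0.trans_le ht
  have hT0 : ∀ q : ℕ × ℕ, 0 ≤ (t ^ (q.1 + q.2))⁻¹ * (c q.1 * c q.2) * (W q.1 * W q.2).coeff 1 :=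
    fun q => by
      have := hc.pos q.1
      have := hc.pos q.2
      have := hWW0 q.1 q.2 1
      positivity
  rw [coeff_densityElem, coeff_densityElem_mul_self,
    ← Finset.sum_filter_add_sum_filter_not (Finset.Icc 1 N) (n₀ ≤ ·)]
  refine add_le_add ?_ ?_
  -- Distinct `n` use distinct terms of the square, so their sum is bounded by the whole square.
  · have hinj : Set.InjOn (fun n : ℕ => (i + 2, n - (i + 2)))
        ({n ∈ Finset.Icc 1 N | n₀ ≤ n} : Finset ℕ) := by
      intro n hn n' hn' heq
      have h1 := (Finset.mem_filter.1 (Finset.mem_coe.1 hn)).2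
      have h2 := (Finset.mem_filter.1 (Finset.mem_coe.1 hn')).2
      have h3 := (Prod.ext_iff.1 heq).2
      simp only at h3
      omega
    calc _ ≤ ∑ n ∈ Finset.Icc 1 N with n₀ ≤ n, ε * ((t ^ (i + 2 + (n - (i + 2))))⁻¹ *
          (c (i + 2) * c (n - (i + 2))) * (W (i + 2) * W (n - (i + 2))).coeff 1) := by
          refine Finset.sum_le_sum fun n hn => ?_
          obtain ⟨m, rfl⟩ := Nat.exists_eq_add_of_le (Finset.mem_filter.1 hn).2
          have h1 := hm₀ (m₀ + m) (Nat.le_add_right _ _)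
          rw [show n₀ + m = m₀ + m + (i + 4) by omega,
            show m₀ + m + (i + 4) - (i + 2) = m₀ + m + 2 by omega,
            show i + 2 + (m₀ + m + 2) = m₀ + m + (i + 4) by omega]
          have h2 : 0 ≤ (t ^ (m₀ + m + (i + 4)))⁻¹ := by positivity
          have h3 := mul_le_mul_of_nonneg_left h1 h2
          simp only [hW] at h3 ⊢
          linarith
      _ ≤ _ := by
          rw [← Finset.mul_sum]
          refine mul_le_mul_of_nonneg_left ?_ hε.le
          rw [← Finset.sum_image (g := fun n : ℕ => (i + 2, n - (i + 2)))
            (f := fun q : ℕ × ℕ => (t ^ (q.1 + q.2))⁻¹ * (c q.1 * c q.2) *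
              (W q.1 * W q.2).coeff 1) hinj]
          refine Finset.sum_le_sum_of_subset_of_nonneg (fun q hq => ?_) fun q _ _ => hT0 q
          obtain ⟨n, hn, rfl⟩ := Finset.mem_image.1 hq
          have h1 := Finset.mem_filter.1 hn
          have h2 := Finset.mem_Icc.1 h1.1
          have h3 := h1.2
          exact Finset.mem_product.2 ⟨Finset.mem_Icc.2 ⟨by simp, by simp only; omega⟩,
            Finset.mem_Icc.2 ⟨by simp only; omega, by simp only; omega⟩⟩
  · calc _ ≤ ∑ n ∈ Finset.Icc 1 N with ¬ n₀ ≤ n, (γ ^ n)⁻¹ * c n * (W n).coeff 1 := by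
          refine Finset.sum_le_sum fun n _ => ?_
          have := hc.pos n
          have := hW0 n 1
          gcongr
      _ ≤ _ := by
          refine Finset.sum_le_sum_of_subset_of_nonneg (fun n hn => ?_) fun n _ _ => ?_
          · have := (Finset.mem_filter.1 hn).2
            exact Finset.mem_range.2 (by omega)
          · have := hc.pos n
            have := hW0 n 1
            positivity

/-- Already the terms pairing the two-letter word `A a` with words of length `m` are unbounded at `t
= γ`. They are comparable to `c m * p^{*m}(e) / γ^m` by the ratio limit. -/
theorem exists_square_term_gt (hh : IsRatioLimit p h) (hγ : IsGrowthRate p γ)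
    (hp : IsProbability p) (A a : Letter p) {c : ℕ → ℝ}
    (hc : SlowlyIncreasing c)
    (hbig : Tendsto (fun n => c n * (p ^ n).coeff 1 / γ ^ n) atTop atTop) (Q : ℝ) :
    ∃ m : ℕ, Q < (γ ^ (2 + m))⁻¹ * (c 2 * c m) *
      (wordElem p (A : G) a 2 * wordElem p (A : G) a m).coeff 1 := by
  have hγ0 := hγ.pos
  set C := p.coeff (A : G) * p.coeff (a : G) with hCdef
  have hC : 0 < C := mul_pos (letter_pos hp A) (letter_pos hp a)
  set B : G := (A : G) * a with hB
  have hc2 := hc.pos 2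
  have h1 := (hbig.atTop_mul_pos (hh.pos (B * B)⁻¹) (hh.tendsto (B * B)⁻¹)).const_mul_atTop
    (show 0 < (γ ^ 4)⁻¹ * c 2 * (C * C) by positivity)
  obtain ⟨m, hm, hm0⟩ := ((h1.eventually_gt_atTop Q).and
    (hbig.eventually_gt_atTop 0)).exists
  refine ⟨m + 2, hm.trans_le ?_⟩
  have hu0 : (p ^ m).coeff 1 ≠ 0 := by
    intro h0
    rw [h0] at hm0
    simp at hm0
  rw [wordElem_mul_wordElem p (A : G) a 0 m, MonoidAlgebra.coeff_single_mul_apply, mul_one,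
    zero_add]
  have h2 : c m ≤ c (m + 2) := hc.mono (by omega)
  have h3 : 0 ≤ (p ^ m).coeff (B * B)⁻¹ := hp.isNonneg.pow _ _
  calc _ = (γ ^ (2 + (m + 2)))⁻¹ * (c 2 * c m) * (C * C * (p ^ m).coeff (B * B)⁻¹) := by
        rw [show 2 + (m + 2) = 4 + m by ring, pow_add]
        field_simp
    _ ≤ _ := by gcongr

theorem isDivergenceWeight_of_tendsto (hh : IsRatioLimit p h) (hγ : IsGrowthRate p γ)
    (hp : IsProbability p) (hgen : GeneratesAsSemigroup p) (A a : Letter p) {c : ℕ → ℝ}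
    (hc : SlowlyIncreasing c)
    (hbig : Tendsto (fun n => c n * (p ^ n).coeff 1 / γ ^ n) atTop atTop) :
    IsDivergenceWeight p A a c := by
  have hγ0 := hγ.pos
  refine ⟨hc, ?_⟩
  rw [hγ.convParam_eq hp hgen]
  simp only [inner_convVec_density, coeffStar_eq, inv_one]
  set e : ℝ → ℕ → ℝ := fun t N => (densityElem p (A : G) a c N t).coeff 1 with he
  set f : ℝ → ℕ → ℝ := fun t N =>
    (densityElem p (A : G) a c N t * densityElem p (A : G) a c N t).coeff 1 with hf
  have hsum : ∀ t, γ < t → Summable fun n => c n * (γ / t) ^ n := fun t ht =>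
    hc.summable_mul_pow (div_pos hγ0 (hγ0.trans ht)) ((div_lt_one (hγ0.trans ht)).2 ht)
  have hemono : ∀ t, γ < t → Monotone (e t) := fun t ht =>
    hp.isNonneg.monotone_coeff_densityElem A a hc.pos (hγ0.trans ht) 1
  have hfmono : ∀ t, γ < t → Monotone (f t) := fun t ht =>
    hp.isNonneg.monotone_coeff_densityElem_mul_self A a hc.pos (hγ0.trans ht) 1
  have hE : ∀ t, γ < t → Tendsto (e t) atTop (𝓝 (⨆ N, e t N)) := fun t ht =>
    tendsto_atTop_ciSup (hemono t ht) ⟨∑' n, c n * (γ / t) ^ n, by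
      rintro _ ⟨N, rfl⟩
      exact hγ.coeff_densityElem_le hp A a hc.pos (hγ0.trans ht) (hsum t ht) N⟩
  have hF : ∀ t, γ < t → Tendsto (f t) atTop (𝓝 (⨆ N, f t N)) := fun t ht =>
    tendsto_atTop_ciSup (hfmono t ht) ⟨(∑' n, c n * (γ / t) ^ n) ^ 2, by
      rintro _ ⟨N, rfl⟩
      exact hγ.coeff_densityElem_mul_self_le hp A a hc.pos (hγ0.trans ht) (hsum t ht) N⟩
  have hFtop : Tendsto (fun t => ⨆ N, f t N) (𝓝[>] γ) atTop := by
    refine tendsto_atTop.2 fun Q => ?_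
    obtain ⟨m, hm⟩ := exists_square_term_gt hh hγ hp A a hc hbig (max Q 0)
    have hm1 : 1 ≤ m := by
      by_contra! hcon
      obtain rfl : m = 0 := by omega
      rw [wordElem.eq_1, mul_zero] at hm
      simp at hm
    -- A single term exceeding `Q` at `t = γ` still exceeds it for `t` slightly above `γ`, and it
    -- bounds `F(t)` from below.
    have hcont : ContinuousAt (fun t : ℝ => (t ^ (2 + m))⁻¹ * (c 2 * c m) *
        (wordElem p (A : G) a 2 * wordElem p (A : G) a m).coeff 1) γ :=
      (((continuousAt_id.pow (2 + m)).inv₀ (pow_ne_zero _ hγ0.ne')).mul_const _).mul_const _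
    filter_upwards [nhdsWithin_le_nhds (hcont.tendsto.eventually_const_lt hm),
      self_mem_nhdsWithin] with t ht1 ht2
    have ht0 : 0 < t := hγ0.trans ht2
    refine (le_max_left Q 0).trans (ht1.le.trans (le_trans ?_
      ((hfmono t ht2).ge_of_tendsto (hF t ht2) (m + 2))))
    simp only [hf, coeff_densityElem_mul_self]
    exact Finset.single_le_sum (s := Finset.Icc 1 (m + 2) ×ˢ Finset.Icc 1 (m + 2))
      (f := fun q : ℕ × ℕ => (t ^ (q.1 + q.2))⁻¹ * (c q.1 * c q.2) *
        (wordElem p (A : G) a q.1 * wordElem p (A : G) a q.2).coeff 1)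
      (fun q _ => by
        have := hc.pos q.1
        have := hc.pos q.2
        exact mul_nonneg (by positivity)
          ((hp.isNonneg.wordElem A a q.1).mul (hp.isNonneg.wordElem A a q.2) 1))
      (a := (2, m)) (Finset.mem_product.2 ⟨Finset.mem_Icc.2 ⟨by simp, by simp⟩,
        Finset.mem_Icc.2 ⟨hm1, by simp⟩⟩)
  refine ⟨fun t => ⨆ N, e t N, fun t => ⨆ N, f t N, hE, hF, hFtop, ?_⟩
  rw [Metric.tendsto_nhds]
  intro ε hε
  obtain ⟨K, hK0, hK⟩ := exists_coeff_densityElem_le hh hγ hp hgen A a hc (half_pos hε)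
  filter_upwards [hFtop.eventually_gt_atTop 0, hFtop.eventually_gt_atTop (K / (ε / 2)),
    self_mem_nhdsWithin] with t h1 h2 ht
  rw [div_lt_iff₀ (half_pos hε)] at h2
  have h3 : ⨆ N, e t N ≤ ε / 2 * (⨆ N, f t N) + K :=
    le_of_tendsto_of_tendsto' (hE t ht) (((hF t ht).const_mul _).add_const K) (hK t (le_of_lt ht))
  have h4 : 0 ≤ ⨆ N, e t N := by
    rw [← coeff_densityElem_zero (p := p) (A : G) a c t 1]
    exact (hemono t ht).ge_of_tendsto (hE t ht) 0
  rw [Real.dist_eq, sub_zero, abs_div, abs_of_pos h1, abs_of_nonneg h4, div_lt_iff₀ h1]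
  linarith

/-! ### Construction of a weight from the return probabilities -/

/-- The least nondecreasing majorant, starting from `1`, of `γ^n / p^{*n}(e)`. -/
def returnEnvelope (p : MonoidAlgebra ℝ G) (γ : ℝ) : ℕ → ℝ
  | 0 => 1
  | n + 1 => max (returnEnvelope p γ n) (γ ^ (n + 1) / (p ^ (n + 1)).coeff 1)

theorem monotone_returnEnvelope : Monotone (returnEnvelope p γ) :=
  monotone_nat_of_le_succ fun _ => le_max_left _ _

theorem one_le_returnEnvelope (n : ℕ) : 1 ≤ returnEnvelope p γ n :=
  monotone_returnEnvelope (Nat.zero_le n)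

theorem le_returnEnvelope (n : ℕ) : γ ^ n / (p ^ n).coeff 1 ≤ returnEnvelope p γ n := by
  cases n with
  | zero => simp [returnEnvelope]
  | succ n => exact le_max_right _ _

/-- The running maximum grows in one step by at most the factor `max 1 (γ u_n / u_{n+1})`, where
`u_n = p^{*n}(e)`, and this tends to `1` by the one-step ratio limit. -/
theorem tendsto_returnEnvelope_ratio (hγ : IsGrowthRate p γ) (hp : IsProbability p)
    (hgen : GeneratesAsSemigroup p) :
    Tendsto (fun n => returnEnvelope p γ (n + 1) / returnEnvelope p γ n) atTop (𝓝 1) := by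
  have hγ0 := hγ.pos
  have hpos := hγ.eventually_coeff_pos hp hgen 1
  have henv : ∀ n, 0 < returnEnvelope p γ n := fun n => one_pos.trans_le (one_le_returnEnvelope n)
  have h1 : Tendsto (fun n => max 1 (γ * ((p ^ (n + 1)).coeff 1 / (p ^ n).coeff 1)⁻¹)) atTop
      (𝓝 1) := by
    have := (tendsto_const_nhds (x := (1 : ℝ))).max
      (((tendsto_return_ratio hγ hp hgen).inv₀ hγ0.ne').const_mul γ)
    rwa [mul_inv_cancel₀ hγ0.ne', max_self] at this
  refine tendsto_of_tendsto_of_tendsto_of_le_of_le' tendsto_const_nhds h1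
    (Eventually.of_forall fun n => ?_) ?_
  · rw [one_le_div (henv n)]
    exact monotone_returnEnvelope (Nat.le_succ n)
  · filter_upwards [hpos, (tendsto_add_atTop_nat 1).eventually hpos] with n h2 h3
    rw [returnEnvelope, ← max_div_div_right (henv n).le, div_self (henv n).ne']
    refine max_le_max le_rfl ?_
    rw [div_le_iff₀ (henv n), inv_div]
    have h4 := le_returnEnvelope (p := p) (γ := γ) n
    calc γ ^ (n + 1) / (p ^ (n + 1)).coeff 1
        = γ * ((p ^ n).coeff 1 / (p ^ (n + 1)).coeff 1) * (γ ^ n / (p ^ n).coeff 1) := by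
          rw [pow_succ]
          field_simp
      _ ≤ _ := mul_le_mul_of_nonneg_left h4 (by positivity)

theorem exists_isDivergenceWeight (hh : IsRatioLimit p h) (hγ : IsGrowthRate p γ)
    (hp : IsProbability p) (hgen : GeneratesAsSemigroup p) (A a : Letter p) :
    ∃ c, IsDivergenceWeight p A a c := by
  have hγ0 := hγ.pos
  have henv : ∀ n, 0 < returnEnvelope p γ n := fun n => one_pos.trans_le (one_le_returnEnvelope n)
  have hnat : Tendsto (fun n : ℕ => (n : ℝ) + 1) atTop atTop :=
    tendsto_atTop_add_const_right _ _ tendsto_natCast_atTop_atTop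
  -- The envelope alone keeps `c n * p^{*n}(e) / γ^n ≥ 1` for large `n`. The factor `n + 1` forces
  -- divergence without spoiling slow growth.
  refine ⟨fun n => (n + 1) * returnEnvelope p γ n,
    isDivergenceWeight_of_tendsto hh hγ hp hgen A a ⟨fun n => ?_, ?_, ?_, ?_⟩ ?_⟩
  · have := henv n
    positivity
  · intro m n hmn
    have := henv m
    have := monotone_returnEnvelope (p := p) (γ := γ) hmn
    dsimp only
    gcongr
  · exact tendsto_atTop_mono (fun n => le_mul_of_one_le_right (by positivity)
      (one_le_returnEnvelope n)) hnat
  · have h1 : Tendsto (fun n : ℕ => 1 + 1 / ((n : ℝ) + 1)) atTop (𝓝 (1 + 0)) :=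
      tendsto_one_div_add_atTop_nhds_zero_nat.const_add 1
    have h2 := h1.mul (tendsto_returnEnvelope_ratio hγ hp hgen)
    rw [add_zero, one_mul] at h2
    refine h2.congr fun n => ?_
    have := henv n
    push_cast
    field_simp
  · refine tendsto_atTop_mono' _ ?_ hnat
    filter_upwards [hγ.eventually_coeff_pos hp hgen 1] with n hn
    have h1 := le_returnEnvelope (p := p) (γ := γ) n
    rw [div_le_iff₀ hn] at h1
    rw [le_div_iff₀ (by positivity), mul_assoc]
    gcongr

end Weight

end RandomWalkDensity

end

theorem mainTheorem12 {G : Type*} [CommGroup G] (p : MonoidAlgebra ℝ G)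
    (hp : RandomWalkDensity.IsProbability p)
    (hgen : RandomWalkDensity.GeneratesAsSemigroup p)
    (haper : RandomWalkDensity.IsAperiodic p) :
    ∃ (γ : ℝ) (Ψ : G → ℝ),
      -- the radius `γ` and the function `Ψ` of the ratio limit theorem
      Tendsto (fun n : ℕ => ((p ^ n).coeff 1) ^ (1 / (n : ℝ))) atTop (𝓝 γ) ∧
      RandomWalkDensity.IsRatioLimitFunction p γ Ψ ∧
      (∀ Φ : G → ℝ, RandomWalkDensity.IsRatioLimitFunction p γ Φ → Φ = Ψ) ∧
      ∀ A a : RandomWalkDensity.Letter p,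
        RandomWalkDensity.convParam p A a = γ ∧
        (∃ c : ℕ → ℝ, RandomWalkDensity.IsDivergenceWeight p A a c) ∧
        ∀ c : ℕ → ℝ, RandomWalkDensity.IsDivergenceWeight p A a c →
        ∀ t : ℕ → ℝ, (∀ k, RandomWalkDensity.convParam p A a < t k) →
          Tendsto t atTop (𝓝 (RandomWalkDensity.convParam p A a)) →
          -- `Υ_{c,*}` is well defined
          (∀ g : G, ∀ k : ℕ, ∃ L : ℝ, Tendsto
            (fun N : ℕ => RandomWalkDensity.quotStar p A a c N (t k) g) atTop (𝓝 L)) ∧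
          (∀ g : G, Bornology.IsBounded
            (Set.range fun k : ℕ => RandomWalkDensity.innerLimit p A a c (t k) g)) ∧
          ∀ g : G, RandomWalkDensity.upsilonStar p A a c t g = 1 / Ψ g⁻¹ := by
  obtain ⟨γ, hγ⟩ := RandomWalkDensity.exists_isGrowthRate hp haper
  obtain ⟨h, hh⟩ := RandomWalkDensity.exists_isRatioLimit hγ hp hgen
  have hΨ := hh.isRatioLimitFunction hγ hp hgen
  refine ⟨γ, fun x => 1 / h x, RandomWalkDensity.tendsto_root hγ.pos hγ.le_pow hγ.ge_pow, hΨ,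
    fun Φ hΦ => hΦ.eq hΨ, fun A a => ⟨hγ.convParam_eq hp hgen A a,
      RandomWalkDensity.exists_isDivergenceWeight hh hγ hp hgen A a, fun c hc t ht htlim => ?_⟩⟩
  have hspec := RandomWalkDensity.upsilonStar_spec hh hγ hp hgen A a hc ht htlim
  refine ⟨fun g => (hspec g).1, fun g => Metric.isBounded_range_of_tendsto _ (hspec g).2,
    fun g => ?_⟩
  rw [one_div_one_div]
  exact (hspec g).2.limsup_eq
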